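/- Let $\mathbb T^n=\mathbb R^n/\mathbb Z^n$ and let $\pi:X\to M$ be a smooth principal $\mathbb T^n$-bundle with connection $\Theta$. Let $\{M_\alpha\}$ be an open cover of $M$, put $X_\alpha=\pi^{-1}(M_\alpha)$, and write $M_{\alpha\beta}$, $X_{\alpha\beta}$, etc. for intersections. Let $\theta_\alpha:X_\alpha\to\mathbb T^n$ be fibre coordinates with $\theta_\alpha-\theta_\beta=-\lambda_{\alpha\beta}$ (mod $\mathbb Z^n$) on $X_{\alpha\beta}$, where $\lambda_{\alpha\beta}=-\lambda_{\beta\alpha}:M_{\alpha\beta}\to\mathbb R^n$ are smooth, and let $\Theta|_{X_\alpha}=d\theta_\alpha+\pi^*A_\alpha$. Set $N_{\alpha\beta\gamma}=\lambda_{\alpha\beta}+\lambda_{\beta\gamma}+\lambda_{\gamma\alpha}$, which takes values in $\mathbb Z^n$. Let a torus-invariant gerbe connection $B_\alpha=B_{2\alpha}+\langle B_{1\alpha},\Theta\rangle+\frac12\langle B_{0\alpha},\Theta\wedge\Theta\rangle$ on $X$ be given in local form, in the following sense: $B_{0\alpha}$ is a smooth function on $M_\alpha$ with values in skew-symmetric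 $n\times n$ matrices, $B_{1\alpha}$ is a smooth $\mathbb R^n$-valued 1-form on $M_\alpha$, and on $M_{\alpha\beta}$ one has $$B_{0\alpha}-B_{0\beta}=m_{\alpha\beta},\qquad B_{1\alpha}-B_{1\beta}=d\tilde h_{\alpha\beta}+m_{\alpha\beta}\bigl(A_\beta-\tfrac12 d\lambda_{\beta\alpha}\bigr),$$ where $m_{\alpha\beta}$ are skew-symmetric integral matrices and $\tilde h_{\alpha\beta}=-\tilde h_{\beta\alpha}:M_{\alpha\beta}\to\mathbb R^n$ are smooth functions such that on $M_{\alpha\beta\gamma}$ $$m_{\alpha\beta}+m_{\beta\gamma}+m_{\gamma\alpha}=0,\qquad \tilde h_{\alpha\beta}+\tilde h_{\beta\gamma}+\tilde h_{\gamma\alpha}\equiv-\tfrac12\bigl[m_{\alpha\beta}\lambda_{\beta\gamma}-m_{\gamma\beta}\lambda_{\beta\alpha}\bigr]-\tfrac12\,m_{\gamma\alpha}N_{\alpha\beta\gamma}\pmod{\mathbb Z^n}$$ (if $\{\lambda_{\alpha\beta}\}$ is an $\mathbb R^n$-valued cocycle, the last term is absent). No condition on $B_{2\alpha}$ is needed.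 Then the functions $$\lambda_{\#\alpha\beta}=\tilde h_{\alpha\beta}-m_{\alpha\beta}\bigl(\theta_\beta+\tfrac12\lambda_{\beta\alpha}\bigr):X_{\alpha\beta}\to\mathbb T^n$$ are smooth and satisfy the cocycle condition $\lambda_{\#\alpha\beta}+\lambda_{\#\beta\gamma}+\lambda_{\#\gamma\alpha}=0$ in $\mathbb T^n$ on $X_{\alpha\beta\gamma}$. They define a smooth principal $\mathbb T^n$-bundle $p:Y\to X$ with fibre coordinates $\theta_{\#\alpha}:p^{-1}(X_\alpha)\to\mathbb T^n$ glued by $\theta_{\#\alpha}-\theta_{\#\beta}=-\lambda_{\#\alpha\beta}$, and $Y$ carries a globally defined connection $\Theta_\#$ given over each $X_\alpha$ by $$\Theta_\#^I=d\theta_{\#\alpha}^I+B_{1\alpha}^I-B_{0\alpha}^{IJ}\Theta_J$$ (pullbacks understood). The bundle $Y$ with these coordinates and this connection is unique up to isomorphism. -/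

import Mathlib

open scoped Manifold ContDiff Topology Matrix

universe u

noncomputable section

/-- The torus `𝕋ⁿ = ℝⁿ / ℤⁿ`, written additively; its Lie algebra is `Fin n → ℝ`. -/
abbrev Torus (n : ℕ) : Type := Fin n → UnitAddCircle

/-- The quotient map `ℝⁿ → 𝕋ⁿ`. -/
def toTorus {n : ℕ} (t : Fin n → ℝ) : Torus n := fun i => (t i : UnitAddCircle)

/-- An integral matrix acting on `𝕋ⁿ`. -/
def Torus.mulVec {n : ℕ} (m : Matrix (Fin n) (Fin n) ℤ) (t : Torus n) : Torus n :=
  fun i => ∑ j, m i j • t j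

/-- An integral matrix regarded as a real one. -/
def realMatrix {n : ℕ} (m : Matrix (Fin n) (Fin n) ℤ) : Matrix (Fin n) (Fin n) ℝ :=
  m.map (fun k => (k : ℝ))

section TorusValued

variable {E : Type*} [NormedAddCommGroup E] [NormedSpace ℝ E] {H : Type*} [TopologicalSpace H]
  (I : ModelWithCorners ℝ E H) {P : Type*} [TopologicalSpace P] [ChartedSpace H P] {n : ℕ}

/-- Near `x`, the torus-valued map `θ` is the class modulo `ℤⁿ` of the map `g`,
and `g` is smooth at `x`. -/
def IsSmoothLiftAt (θ : P → Torus n) (g : P → Fin n → ℝ) (x : P) : Prop :=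
  ContMDiffAt I 𝓘(ℝ, Fin n → ℝ) ∞ g x ∧ ∀ᶠ y in 𝓝 x, θ y = toTorus (g y)

/-- Smoothness, on an open set `s`, of a map into the manifold `ℝⁿ / ℤⁿ`. -/
def TorusSmoothOn (θ : P → Torus n) (s : Set P) : Prop :=
  ∀ x ∈ s, ∃ g, IsSmoothLiftAt I θ g x

/-- The differential `df` of an `ℝⁿ`-valued function, an `ℝⁿ`-valued one-form. -/
def vecDiff (f : P → Fin n → ℝ) (x : P) : TangentSpace I x →L[ℝ] (Fin n → ℝ) :=
  mfderiv I 𝓘(ℝ, Fin n → ℝ) f x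

open Classical in
/-- The differential `dθ` of a torus-valued map, an `ℝⁿ`-valued one-form: the differential of any
smooth local lift (see `torusDiff_eq`), and zero where there is none. -/
def torusDiff (θ : P → Torus n) (x : P) : TangentSpace I x →L[ℝ] (Fin n → ℝ) :=
  if h : ∃ g, IsSmoothLiftAt I θ g x then
    vecDiff I h.choose x
  else 0

theorem toTorus_eq_iff (a b : Fin n → ℝ) :
    toTorus a = toTorus b ↔ ∀ i, ∃ k : ℤ, a i - b i = k := by
  simp only [toTorus, funext_iff]
  refine forall_congr' fun i => ?_
  rw [← sub_eq_zero, ← AddCircle.coe_sub, AddCircle.coe_eq_zero_iff]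
  simp [eq_comm]

/-- The differential of a torus-valued map does not depend on the choice of the lift. -/
theorem torusDiff_eq {θ : P → Torus n} {g : P → Fin n → ℝ} {x : P}
    (hg : IsSmoothLiftAt I θ g x) :
    torusDiff I θ x = vecDiff I g x := by
  have h : ∃ g, IsSmoothLiftAt I θ g x := ⟨g, hg⟩
  rw [torusDiff, dif_pos h]
  have hs := h.choose_spec
  set f := h.choose
  have hcont : ContinuousAt (fun y => f y - g y) x :=
    hs.1.continuousAt.sub hg.1.continuousAt
  have hclose : ∀ᶠ y in 𝓝 x, dist (f y - g y) (f x - g x) < 1 :=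
    (Metric.tendsto_nhds.1 hcont) 1 one_pos
  have key : f =ᶠ[𝓝 x] fun y => g y + (f x - g x) := by
    filter_upwards [hs.2, hg.2, hclose] with y h1 h2 h3
    have e1 := (toTorus_eq_iff _ _).1 (h1.symm.trans h2)
    have e2 := (toTorus_eq_iff _ _).1 (hs.2.self_of_nhds.symm.trans hg.2.self_of_nhds)
    funext i
    obtain ⟨k, hk⟩ := e1 i
    obtain ⟨l, hl⟩ := e2 i
    have h4 := lt_of_le_of_lt (dist_le_pi_dist (f y - g y) (f x - g x) i) h3
    simp only [Pi.sub_apply, hk, hl, Real.dist_eq] at h4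
    have h5 : k = l := by
      have : |k - l| < 1 := by exact_mod_cast h4
      have := Int.abs_lt_one_iff.1 this
      omega
    simp only [Pi.add_apply, Pi.sub_apply, hl]
    rw [h5] at hk
    linarith
  unfold vecDiff
  rw [key.mfderiv_eq]
  have hd : MDifferentiableAt I 𝓘(ℝ, Fin n → ℝ) g x := hg.1.mdifferentiableAt (by simp)
  have hadd := hd.hasMFDerivAt.add
    (hasMFDerivAt_const (I := I) (I' := 𝓘(ℝ, Fin n → ℝ)) (f x - g x) x)
  have := hadd.mfderiv
  exact this.trans (add_zero _)

/-- A vector-valued one-form is smooth over the open set `U` when it is smooth as a function on the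
tangent bundle over `U` (it is linear on the fibres by its type). -/
def SmoothFormOn [IsManifold I ∞ P] {F : Type*} [NormedAddCommGroup F] [NormedSpace ℝ F]
    (U : Set P) (η : ∀ x : P, TangentSpace I x →L[ℝ] F) : Prop :=
  ContMDiffOn I.tangent 𝓘(ℝ, F) ∞ (fun v : TangentBundle I P => η v.1 v.2) {v | v.1 ∈ U}

end TorusValued

section Bundles

variable {EB : Type*} [NormedAddCommGroup EB] [NormedSpace ℝ EB]
  {HB : Type*} [TopologicalSpace HB] (IB : ModelWithCorners ℝ EB HB)
  {EP : Type*} [NormedAddCommGroup EP] [NormedSpace ℝ EP]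
  {HP : Type*} [TopologicalSpace HP] (IP : ModelWithCorners ℝ EP HP)
  {B : Type*} [TopologicalSpace B] [ChartedSpace HB B]
  {P : Type*} [TopologicalSpace P] [ChartedSpace HP P]
  {n : ℕ} [AddAction (Torus n) P] {ι : Type*}

/-- `π : P → B` is a smooth principal `𝕋ⁿ`-bundle: the action of `𝕋ⁿ = ℝⁿ / ℤⁿ` on `P` is smooth,
simply transitive on the fibres of the smooth map `π`, and `π` has smooth local sections. -/
structure IsPrincipalTorusBundle (π : P → B) : Prop where
  smooth_proj : ContMDiff IP IB ∞ π
  smooth_action : ContMDiff (𝓘(ℝ, Fin n → ℝ).prod IP) IP ∞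
    (fun q : (Fin n → ℝ) × P => toTorus q.1 +ᵥ q.2)
  proj_vadd : ∀ (t : Torus n) (q : P), π (t +ᵥ q) = π q
  simply_transitive : ∀ q q' : P, π q = π q' → ∃! t : Torus n, t +ᵥ q = q'
  local_section : ∀ b : B, ∃ (W : Set B) (σ : B → P), IsOpen W ∧ b ∈ W ∧
    ContMDiffOn IB IP ∞ σ W ∧ ∀ b' ∈ W, π (σ b') = b'

/-- `θ` is a torus fibre coordinate over `U`: a smooth equivariant map `π⁻¹ U → 𝕋ⁿ`. For a principal
bundle `π`, the map `(π, θ) : π⁻¹ U → U × 𝕋ⁿ` is then a trivialization. -/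
structure IsFibreCoordinate (π : P → B) (U : Set B) (θ : P → Torus n) : Prop where
  smooth : TorusSmoothOn IP θ (π ⁻¹' U)
  equivariant : ∀ (t : Torus n) (q : P), π q ∈ U → θ (t +ᵥ q) = t + θ q

/-- `π : P → B` is a principal torus bundle with fibre coordinates `θ α` over the open sets `U α`
that are glued by `θ α - θ β = - c α β`. -/
structure IsGluedTorusBundle (U : ι → Set B) (c : ι → ι → B → Torus n)
    (π : P → B) (θ : ι → P → Torus n) : Prop where
  principal : IsPrincipalTorusBundle (n := n) IB IP π
  coordinate : ∀ α, IsFibreCoordinate IP π (U α) (θ α)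
  gluing : ∀ α β q, π q ∈ U α ∩ U β → θ α q - θ β q = - c α β (π q)

/-- `Θ` is a connection on a principal `𝕋ⁿ`-bundle with total space `P`: a smooth `ℝⁿ`-valued
one-form that takes the fundamental vector field of `v ∈ ℝⁿ` (the velocity at `s = 0` of
`s ↦ s +ᵥ q`) to `v`, and is invariant under the action. -/
structure IsTorusConnection [IsManifold IP ∞ P]
    (Θ : ∀ q : P, TangentSpace IP q →L[ℝ] (Fin n → ℝ)) : Prop where
  smooth : SmoothFormOn IP Set.univ Θ
  fundamental : ∀ (q : P) (v : Fin n → ℝ),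
    Θ (toTorus (0 : Fin n → ℝ) +ᵥ q)
      (mfderiv 𝓘(ℝ, Fin n → ℝ) IP (fun s : Fin n → ℝ => toTorus s +ᵥ q) 0 v) = v
  invariant : ∀ (t : Torus n) (q : P) (v : TangentSpace IP q),
    Θ (t +ᵥ q) (mfderiv IP IP (fun q' : P => t +ᵥ q') q v) = Θ q v

end Bundles

section Gerbe

variable {E : Type*} [NormedAddCommGroup E] [NormedSpace ℝ E]
  {H : Type*} [TopologicalSpace H] (I : ModelWithCorners ℝ E H)
  {EX : Type*} [NormedAddCommGroup EX] [NormedSpace ℝ EX]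
  {HX : Type*} [TopologicalSpace HX] (J : ModelWithCorners ℝ EX HX)
  {M : Type*} [TopologicalSpace M] [ChartedSpace H M] [IsManifold I ∞ M]
  {X : Type*} [TopologicalSpace X] [ChartedSpace HX X] [IsManifold J ∞ X]
  {n : ℕ} [AddAction (Torus n) X] {ι : Type*}

/-- The torus bundle `π : X → M` in its local description: an open cover `U` of `M`, fibre
coordinates `θ α` glued by real-valued functions, `θ α - θ β = - lam α β` modulo `ℤⁿ`, and a
connection `Θ = dθ α + π^* A α`. -/
structure IsLocalTorusBundle (U : ι → Set M) (lam : ι → ι → M → Fin n → ℝ)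
    (A : ι → ∀ x : M, TangentSpace I x →L[ℝ] (Fin n → ℝ))
    (π : X → M) (θ : ι → X → Torus n)
    (Θ : ∀ x : X, TangentSpace J x →L[ℝ] (Fin n → ℝ)) : Prop where
  isOpen : ∀ α, IsOpen (U α)
  cover : ⋃ α, U α = Set.univ
  lam_smooth : ∀ α β, ContMDiffOn I 𝓘(ℝ, Fin n → ℝ) ∞ (lam α β) (U α ∩ U β)
  lam_skew : ∀ α β, ∀ x ∈ U α ∩ U β, lam β α x = - lam α β x
  glued : IsGluedTorusBundle I J U (fun α β x => toTorus (lam α β x)) π θ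
  connection : IsTorusConnection (n := n) J Θ
  A_smooth : ∀ α, SmoothFormOn I (U α) (A α)
  connection_local : ∀ α x, π x ∈ U α → ∀ v : TangentSpace J x,
    Θ x v = torusDiff J (θ α) x v + A α (π x) (mfderiv J I π x v)

/-- The part `B₀`, `B₁` of a torus-invariant gerbe connection
`B α = B₂ α + ⟨B₁ α, Θ⟩ + ½ ⟨B₀ α, Θ ∧ Θ⟩`, with gluing data `m`, `h` on twofold overlaps.
The term `½ m γ α N`, with `N` the integral vector `lam α β + lam β γ + lam γ α`, is absent when
`lam` is an `ℝⁿ`-valued cocycle. -/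
structure IsInvariantGerbe (U : ι → Set M) (lam : ι → ι → M → Fin n → ℝ)
    (A : ι → ∀ x : M, TangentSpace I x →L[ℝ] (Fin n → ℝ))
    (m : ι → ι → M → Matrix (Fin n) (Fin n) ℤ)
    (h : ι → ι → M → Fin n → ℝ)
    (B₀ : ι → M → Matrix (Fin n) (Fin n) ℝ)
    (B₁ : ι → ∀ x : M, TangentSpace I x →L[ℝ] (Fin n → ℝ)) : Prop where
  B₀_smooth : ∀ α i j, ContMDiffOn I 𝓘(ℝ, ℝ) ∞ (fun x => B₀ α x i j) (U α)
  B₀_skew : ∀ α, ∀ x ∈ U α, (B₀ α x)ᵀ = - B₀ α x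
  B₁_smooth : ∀ α, SmoothFormOn I (U α) (B₁ α)
  h_smooth : ∀ α β, ContMDiffOn I 𝓘(ℝ, Fin n → ℝ) ∞ (h α β) (U α ∩ U β)
  h_skew : ∀ α β, ∀ x ∈ U α ∩ U β, h β α x = - h α β x
  m_skew : ∀ α β, ∀ x ∈ U α ∩ U β, (m α β x)ᵀ = - m α β x
  B₀_gluing : ∀ α β, ∀ x ∈ U α ∩ U β, B₀ α x - B₀ β x = realMatrix (m α β x)
  B₁_gluing : ∀ α β, ∀ x ∈ U α ∩ U β, ∀ v : TangentSpace I x,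
    B₁ α x v - B₁ β x v = vecDiff I (h α β) x v +
      realMatrix (m α β x) *ᵥ
        (A β x v - (1 / 2 : ℝ) • vecDiff I (lam β α) x v)
  m_cocycle : ∀ α β γ, ∀ x ∈ U α ∩ U β ∩ U γ, m α β x + m β γ x + m γ α x = 0
  h_cocycle : ∀ α β γ, ∀ x ∈ U α ∩ U β ∩ U γ,
    toTorus (h α β x + h β γ x + h γ α x) =
      toTorus (- (1 / 2 : ℝ) •
          (realMatrix (m α β x) *ᵥ lam β γ x - realMatrix (m γ β x) *ᵥ lam β α x)
        - (1 / 2 : ℝ) •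
          (realMatrix (m γ α x) *ᵥ (lam α β x + lam β γ x + lam γ α x)))

/-- The function `λ_#αβ = h_αβ - m_αβ (θ_β + ½ λ_βα)` with values in `𝕋ⁿ`. -/
def lamSharp (lam : ι → ι → M → Fin n → ℝ) (m : ι → ι → M → Matrix (Fin n) (Fin n) ℤ)
    (h : ι → ι → M → Fin n → ℝ) (π : X → M) (θ : ι → X → Torus n) (α β : ι) (x : X) : Torus n :=
  toTorus (h α β (π x)) -
    (Torus.mulVec (m α β (π x)) (θ β x) +
      toTorus ((1 / 2 : ℝ) • (realMatrix (m α β (π x)) *ᵥ lam β α (π x))))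

variable {EY : Type*} [NormedAddCommGroup EY] [NormedSpace ℝ EY]
  {HY : Type*} [TopologicalSpace HY] (K : ModelWithCorners ℝ EY HY)
  {Y : Type*} [TopologicalSpace Y] [ChartedSpace HY Y] [IsManifold K ∞ Y] [AddAction (Torus n) Y]

/-- `p : Y → X` is a principal torus bundle with fibre coordinates `θs α` over `π⁻¹ (U α)` glued by
`θs α - θs β = - c α β`, and `Θs` is a connection on it which over `π⁻¹ (U α)` equals
`dθs α + B₁ α - B₀ α Θ` (pullbacks understood). -/
structure IsSharpBundle (U : ι → Set M) (c : ι → ι → X → Torus n)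
    (B₀ : ι → M → Matrix (Fin n) (Fin n) ℝ)
    (B₁ : ι → ∀ x : M, TangentSpace I x →L[ℝ] (Fin n → ℝ))
    (π : X → M) (Θ : ∀ x : X, TangentSpace J x →L[ℝ] (Fin n → ℝ))
    (p : Y → X) (θs : ι → Y → Torus n)
    (Θs : ∀ y : Y, TangentSpace K y →L[ℝ] (Fin n → ℝ)) : Prop where
  glued : IsGluedTorusBundle J K (fun α => π ⁻¹' U α) c p θs
  connection : IsTorusConnection (n := n) K Θs
  connection_local : ∀ α y, π (p y) ∈ U α → ∀ v : TangentSpace K y,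
    Θs y v = torusDiff K (θs α) y v
      + B₁ α (π (p y)) (mfderiv J I π (p y) (mfderiv K J p y v))
      - B₀ α (π (p y)) *ᵥ Θ (p y) (mfderiv K J p y v)

end Gerbe

end

/-! Everything about torus-valued maps is reduced to real vectors through local lifts. Two
continuous lifts of one map differ locally by a constant, so smoothness and the differential do not
depend on the lift. Integral matrices act on `Torus n` compatibly with `toTorus`, and the matrices
`m α β` are locally constant because they are integral differences of continuous functions. Hence
`lamSharp` is smooth.

For the cocycle condition, lift `θ β x` to a vector `t`; the gluing rule then lifts `θ γ x` to `t +
lam β γ` and `θ α x` to `t - lam α β`. In the sum of the three values of `lamSharp` the coefficient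
of `t` is `m α β + m β γ + m γ α = 0`, and the terms in `lam` are exactly those prescribed by
`h_cocycle`, so what remains is an identity in `ℝⁿ` (`lamSharp_cocycle`).

A smooth torus cocycle glues the products `V α × 𝕋ⁿ` by translations. Charts come from a chart of
the base and an open unit cube in the fibre; transition maps are smooth since their fibre part is a
continuous lift of a smooth torus-valued map (`exists_isGluedTorusBundle`).

For the connection, put `ζ α = π^* B₁ α - B₀ α Θ`. Inserting `Θ = dθ β + A β` into the difference of
the `B₀` terms cancels the term in `A β` coming from `B₁_gluing`, and leaves `ζ α - ζ β = d(lamSharp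
α β)` (`gerbeForm_sub_gerbeForm`). This compensates the change of `dθs α`, so the forms `dθs α + p^*
ζ α` agree on overlaps (`IsGluedTorusBundle.exists_connection`).

For uniqueness, a point is determined by its projection and one fibre coordinate, so matching
coordinates defines mutually inverse smooth maps. They respect the connections because both are
given by the same local formula (`IsSharpBundle.connection_comp_map`). -/

noncomputable section

/-! ### The torus as a quotient: charts and lifts -/

section TorusBasics

variable {n : ℕ}

theorem toTorus_add (a b : Fin n → ℝ) : toTorus (a + b) = toTorus a + toTorus b := rfl

theorem toTorus_sub (a b : Fin n → ℝ) : toTorus (a - b) = toTorus a - toTorus b := rfl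

theorem toTorus_zero : toTorus (0 : Fin n → ℝ) = 0 := rfl

theorem continuous_toTorus : Continuous (toTorus : (Fin n → ℝ) → Torus n) :=
  continuous_pi fun i => (AddCircle.continuous_mk' 1).comp (continuous_apply i)

theorem toTorus_surjective : Function.Surjective (toTorus : (Fin n → ℝ) → Torus n) := by
  intro t
  choose g hg using fun i => QuotientAddGroup.mk_surjective (t i)
  exact ⟨g, funext hg⟩

/-- Integer multiples pass to the quotient by `ℤⁿ`; this is what turns identities between
torus-valued expressions into identities between real vectors. -/
theorem Torus.mulVec_toTorus (m : Matrix (Fin n) (Fin n) ℤ) (a : Fin n → ℝ) :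
    Torus.mulVec m (toTorus a) = toTorus (realMatrix m *ᵥ a) := by
  funext i
  simp only [Torus.mulVec, toTorus, Matrix.mulVec, dotProduct, realMatrix, Matrix.map_apply]
  have : ∀ s : Finset (Fin n), ((∑ j ∈ s, (m i j : ℝ) * a j : ℝ) : UnitAddCircle) =
      ∑ j ∈ s, m i j • (a j : UnitAddCircle) := by
    intro s
    induction s using Finset.cons_induction with
    | empty => simp
    | cons j s hj ih =>
      rw [Finset.sum_cons, Finset.sum_cons, AddCircle.coe_add, ih, ← zsmul_eq_mul,
        AddCircle.coe_zsmul]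
  exact (this _).symm

/-- The chart of the torus inverse to the restriction of `toTorus` to the open unit cube at `a`. -/
def torusChart (a : Fin n → ℝ) : OpenPartialHomeomorph (Torus n) (Fin n → ℝ) :=
  (OpenPartialHomeomorph.pi fun i => AddCircle.openPartialHomeomorphCoe (1 : ℝ) (a i)).symm

theorem toTorus_torusChart {a : Fin n → ℝ} {t : Torus n} (ht : t ∈ (torusChart a).source) :
    toTorus (torusChart a t) = t :=
  (torusChart a).left_inv ht

theorem exists_mem_torusChart_source (t : Torus n) :
    ∃ a : Fin n → ℝ, t ∈ (torusChart a).source := by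
  obtain ⟨g, rfl⟩ := toTorus_surjective t
  -- The shift by one half places `g` at the centre of the open unit cube with corner `a`.
  refine ⟨g - fun _ => 1 / 2, ?_⟩
  have : g ∈ (torusChart (g - fun _ => 1 / 2)).target := by
    intro i _
    simp only [AddCircle.openPartialHomeomorphCoe_source, Pi.sub_apply, Set.mem_Ioo]
    constructor <;> linarith
  exact (torusChart (g - fun _ => 1 / 2)).map_target this

/-- Two continuous lifts of the same torus-valued map differ locally by a constant. -/
theorem eventually_eq_add_const_of_toTorus_eq {P : Type*} [TopologicalSpace P]
    {f g : P → Fin n → ℝ} {x : P} (hf : ContinuousAt f x) (hg : ContinuousAt g x)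
    (h : ∀ᶠ y in 𝓝 x, toTorus (f y) = toTorus (g y)) :
    f =ᶠ[𝓝 x] fun y => g y + (f x - g x) := by
  -- The difference of the lifts takes integral values, so staying within distance less than 1 of
  -- its value at `x` forces it to equal that value.
  have hclose : ∀ᶠ y in 𝓝 x, dist (f y - g y) (f x - g x) < 1 :=
    (Metric.tendsto_nhds.1 (hf.sub hg)) 1 one_pos
  filter_upwards [h, hclose] with y h1 h3
  have e1 := (toTorus_eq_iff _ _).1 h1
  have e2 := (toTorus_eq_iff _ _).1 h.self_of_nhds
  funext i
  obtain ⟨k, hk⟩ := e1 i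
  obtain ⟨l, hl⟩ := e2 i
  have h4 := lt_of_le_of_lt (dist_le_pi_dist (f y - g y) (f x - g x) i) h3
  simp only [Pi.sub_apply, hk, hl, Real.dist_eq] at h4
  have h5 : k = l := by
    have : |k - l| < 1 := by exact_mod_cast h4
    have := Int.abs_lt_one_iff.1 this
    omega
  simp only [Pi.add_apply, Pi.sub_apply, hl]
  rw [h5] at hk
  linarith

end TorusBasics

/-! ### Smooth local lifts of torus-valued maps -/

section SmoothLift

variable {E : Type*} [NormedAddCommGroup E] [NormedSpace ℝ E] {H : Type*} [TopologicalSpace H]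
  {I : ModelWithCorners ℝ E H} {P : Type*} [TopologicalSpace P] [ChartedSpace H P] {n : ℕ}
  {E' : Type*} [NormedAddCommGroup E'] [NormedSpace ℝ E'] {H' : Type*} [TopologicalSpace H']
  {I' : ModelWithCorners ℝ E' H'} {P' : Type*} [TopologicalSpace P'] [ChartedSpace H' P']

/-- Near `x` the two lifts differ by a constant. This supplies the smoothness of the fibre component
of a chart, which is known beforehand only to be a continuous lift. -/
theorem contMDiffAt_of_toTorus_eq {f g : P → Fin n → ℝ} {x : P} (hf : ContinuousAt f x)
    (hg : ContMDiffAt I 𝓘(ℝ, Fin n → ℝ) ∞ g x)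
    (h : ∀ᶠ y in 𝓝 x, toTorus (f y) = toTorus (g y)) :
    ContMDiffAt I 𝓘(ℝ, Fin n → ℝ) ∞ f x :=
  (hg.add contMDiffAt_const).congr_of_eventuallyEq
    (eventually_eq_add_const_of_toTorus_eq hf hg.continuousAt h)

theorem ContMDiffAt.mulVec {f : P → Fin n → ℝ} {x : P}
    (hf : ContMDiffAt I 𝓘(ℝ, Fin n → ℝ) ∞ f x) (b : Matrix (Fin n) (Fin n) ℝ) :
    ContMDiffAt I 𝓘(ℝ, Fin n → ℝ) ∞ (fun y => b *ᵥ f y) x :=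
  b.mulVecLin.toContinuousLinearMap.contMDiff.contMDiffAt.comp x hf

namespace IsSmoothLiftAt

variable {θ η : P → Torus n} {f g : P → Fin n → ℝ} {x : P}

theorem continuousAt (h : IsSmoothLiftAt I θ f x) : ContinuousAt θ x :=
  (continuous_toTorus.continuousAt.comp h.1.continuousAt).congr (h.2.mono fun _ hy => hy.symm)

theorem congr (h : IsSmoothLiftAt I θ f x) (e : η =ᶠ[𝓝 x] θ) : IsSmoothLiftAt I η f x :=
  ⟨h.1, by filter_upwards [h.2, e] with y h1 h2 using h2.trans h1⟩

theorem toTorus_comp (h : ContMDiffAt I 𝓘(ℝ, Fin n → ℝ) ∞ f x) :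
    IsSmoothLiftAt I (fun y => toTorus (f y)) f x :=
  ⟨h, Filter.Eventually.of_forall fun _ => rfl⟩

theorem add (hf : IsSmoothLiftAt I θ f x) (hg : IsSmoothLiftAt I η g x) :
    IsSmoothLiftAt I (fun y => θ y + η y) (fun y => f y + g y) x :=
  ⟨hf.1.add hg.1, by filter_upwards [hf.2, hg.2] with y h1 h2; rw [h1, h2]; rfl⟩

theorem sub (hf : IsSmoothLiftAt I θ f x) (hg : IsSmoothLiftAt I η g x) :
    IsSmoothLiftAt I (fun y => θ y - η y) (fun y => f y - g y) x :=
  ⟨hf.1.sub hg.1, by filter_upwards [hf.2, hg.2] with y h1 h2; rw [h1, h2]; rfl⟩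

theorem comp {φ : P' → P} {y : P'} (hf : IsSmoothLiftAt I θ f x)
    (hφ : ContMDiffAt I' I ∞ φ y) (hx : φ y = x := by rfl) :
    IsSmoothLiftAt I' (fun z => θ (φ z)) (fun z => f (φ z)) y := by
  subst hx
  exact ⟨hf.1.comp y hφ, hφ.continuousAt.eventually hf.2⟩

theorem mulVec {m : P → Matrix (Fin n) (Fin n) ℤ} {m₀ : Matrix (Fin n) (Fin n) ℤ}
    (hm : ∀ᶠ y in 𝓝 x, m y = m₀) (hf : IsSmoothLiftAt I θ f x) :
    IsSmoothLiftAt I (fun y => Torus.mulVec (m y) (θ y)) (fun y => realMatrix m₀ *ᵥ f y) x := by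
  refine ⟨?_, ?_⟩
  · exact hf.1.mulVec _
  · filter_upwards [hm, hf.2] with y h1 h2
    rw [h1, h2, Torus.mulVec_toTorus]

end IsSmoothLiftAt

namespace TorusSmoothOn

variable {θ η : P → Torus n} {s : Set P}

theorem continuousOn (h : TorusSmoothOn I θ s) : ContinuousOn θ s := fun x hx =>
  let ⟨_, hg⟩ := h x hx
  hg.continuousAt.continuousWithinAt

end TorusSmoothOn

end SmoothLift

/-! ### Separation and countability of total spaces -/

section FiberBundleCoreTopology

variable {ι B F : Type*} [TopologicalSpace B] [TopologicalSpace F] (Z : FiberBundleCore ι B F)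

/-- Points over different base points are separated in the base; points of one fibre lie in a common
trivialization, where the product is Hausdorff. -/
theorem FiberBundleCore.t2Space_totalSpace [T2Space B] [T2Space F] : T2Space Z.TotalSpace := by
  refine ⟨fun y y' hne => ?_⟩
  by_cases hp : y.proj = y'.proj
  · have hy : y ∈ (Z.localTrivAt y.proj).source := Z.mem_localTrivAt_source _ _ |>.2
      (Z.mem_localTrivAt_baseSet _)
    have hy' : y' ∈ (Z.localTrivAt y.proj).source := Z.mem_localTrivAt_source _ _ |>.2
      (hp ▸ Z.mem_localTrivAt_baseSet _)
    have hne' : Z.localTrivAt y.proj y ≠ Z.localTrivAt y.proj y' := fun h =>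
      hne ((Z.localTrivAt y.proj).injOn hy hy' h)
    obtain ⟨u, v, hu, hv, h1, h2, h3⟩ := t2_separation hne'
    exact ⟨_, _, (Z.localTrivAt y.proj).toOpenPartialHomeomorph.isOpen_inter_preimage hu,
      (Z.localTrivAt y.proj).toOpenPartialHomeomorph.isOpen_inter_preimage hv,
      ⟨hy, h1⟩, ⟨hy', h2⟩,
      Set.disjoint_left.2 fun z hz hz' => Set.disjoint_left.1 h3 hz.2 hz'.2⟩
  · obtain ⟨u, v, hu, hv, h1, h2, h3⟩ := t2_separation hp
    have hc : Continuous (Bundle.TotalSpace.proj : Z.TotalSpace → B) :=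
      FiberBundle.continuous_proj F Z.Fiber
    exact ⟨_, _, hu.preimage hc, hv.preimage hc, h1, h2, h3.preimage _⟩

/-- By the Lindelöf property of the base, countably many trivializing sets suffice, and each
trivialization domain is homeomorphic to a subspace of `B × F`. -/
theorem FiberBundleCore.secondCountableTopology_totalSpace [SecondCountableTopology B]
    [SecondCountableTopology F] : SecondCountableTopology Z.TotalSpace := by
  have hcov : ⋃ i, Z.baseSet i = Set.univ :=
    Set.eq_univ_of_forall fun x => Set.mem_iUnion.2 ⟨_, Z.mem_baseSet_at x⟩
  obtain ⟨T, hT, hTU⟩ := TopologicalSpace.isOpen_iUnion_countable Z.baseSet Z.isOpen_baseSet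
  have := hT.to_subtype
  have hsc : ∀ i : T, SecondCountableTopology (Z.localTriv i.1).source := fun i =>
    (Z.localTriv i.1).toOpenPartialHomeomorph.toHomeomorphSourceTarget.secondCountableTopology
  refine TopologicalSpace.secondCountableTopology_of_countable_cover
    (fun i : T => (Z.localTriv i.1).open_source) ?_
  · refine Set.eq_univ_of_forall fun y => ?_
    have : y.proj ∈ ⋃ i ∈ T, Z.baseSet i := by rw [hTU, hcov]; trivial
    simp only [Set.mem_iUnion] at this
    obtain ⟨i, hi, hy⟩ := this
    exact Set.mem_iUnion.2 ⟨⟨i, hi⟩, hy⟩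

end FiberBundleCoreTopology

/-! ### Gluing a bundle from a torus cocycle -/

section TorusCocycle

variable {EX : Type*} [NormedAddCommGroup EX] [NormedSpace ℝ EX]
  {HX : Type*} [TopologicalSpace HX] {J : ModelWithCorners ℝ EX HX}
  {X : Type u} [TopologicalSpace X] [ChartedSpace HX X]
  {n : ℕ} {ι : Type*} {V : ι → Set X} {c : ι → ι → X → Torus n}

/-- A smooth torus-valued cocycle `c` subordinate to the open cover `V`. -/
structure IsTorusCocycle (J : ModelWithCorners ℝ EX HX) (V : ι → Set X)
    (c : ι → ι → X → Torus n) : Prop where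
  isOpen : ∀ α, IsOpen (V α)
  cover : ⋃ α, V α = Set.univ
  smooth : ∀ α β, TorusSmoothOn J (c α β) (V α ∩ V β)
  self_eq_zero : ∀ α, ∀ x ∈ V α, c α α x = 0
  cocycle : ∀ α β γ, ∀ x ∈ V α ∩ V β ∩ V γ, c α β x + c β γ x + c γ α x = 0

namespace IsTorusCocycle

theorem symm (hc : IsTorusCocycle J V c) {α β : ι} {x : X} (hα : x ∈ V α) (hβ : x ∈ V β) :
    c β α x = -c α β x := by
  have h := hc.cocycle α β α x ⟨⟨hα, hβ⟩, hα⟩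
  rw [hc.self_eq_zero α x hα, add_zero] at h
  exact (neg_eq_of_add_eq_zero_right h).symm

theorem trans (hc : IsTorusCocycle J V c) {α β γ : ι} {x : X} (hα : x ∈ V α) (hβ : x ∈ V β)
    (hγ : x ∈ V γ) : c α β x + c β γ x = c α γ x := by
  have h := hc.cocycle α β γ x ⟨⟨hα, hβ⟩, hγ⟩
  rw [hc.symm hα hγ] at h
  exact add_neg_eq_zero.1 h

theorem exists_mem (hc : IsTorusCocycle J V c) (x : X) : ∃ α, x ∈ V α :=
  Set.mem_iUnion.1 (hc.cover ▸ Set.mem_univ x)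

/-- The fibre bundle with fibre the torus glued by the translations `c α β`. -/
def core (hc : IsTorusCocycle J V c) : FiberBundleCore ι X (Torus n) where
  baseSet := V
  isOpen_baseSet := hc.isOpen
  indexAt x := (hc.exists_mem x).choose
  mem_baseSet_at x := (hc.exists_mem x).choose_spec
  coordChange α β x t := t + c α β x
  coordChange_self α x hx t := by rw [hc.self_eq_zero α x hx, add_zero]
  continuousOn_coordChange α β := continuousOn_snd.add
    ((hc.smooth α β).continuousOn.comp continuousOn_fst fun _ hq => hq.1)
  coordChange_comp α β γ x hx t := by rw [add_assoc, hc.trans hx.1.1 hx.1.2 hx.2]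

variable (hc : IsTorusCocycle J V c)

/-- The fibre coordinate over `V α` of the glued bundle. -/
def coord (α : ι) (y : hc.core.TotalSpace) : Torus n :=
  (hc.core.localTriv α y).2

/-- The fibre component of a point of the glued bundle. -/
def fibreComponent (y : hc.core.TotalSpace) : Torus n := y.2

theorem coord_def (α : ι) (y : hc.core.TotalSpace) :
    hc.coord α y = hc.fibreComponent y + c (hc.core.indexAt y.proj) α y.proj := rfl

theorem coord_sub_coord {α β : ι} {y : hc.core.TotalSpace} (hα : y.proj ∈ V α)
    (hβ : y.proj ∈ V β) : hc.coord α y - hc.coord β y = -c α β y.proj := by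
  have h0 := hc.core.mem_baseSet_at y.proj
  rw [coord_def, coord_def, ← hc.trans h0 hα hβ]
  abel

theorem coord_eq {α β : ι} {y : hc.core.TotalSpace} (hα : y.proj ∈ V α)
    (hβ : y.proj ∈ V β) : hc.coord β y = hc.coord α y + c α β y.proj := by
  have := hc.coord_sub_coord hα hβ
  rw [← sub_eq_iff_eq_add', ← neg_inj, ← this]
  abel

/-- The torus action on the glued bundle by translations of the fibres. -/
instance addAction : AddAction (Torus n) hc.core.TotalSpace where
  vadd t y := ⟨y.1, t + hc.fibreComponent y⟩
  zero_vadd y := congrArg (fun s : Torus n => (⟨y.1, s⟩ : hc.core.TotalSpace)) (zero_add _)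
  add_vadd _ _ y :=
    congrArg (fun s : Torus n => (⟨y.1, s⟩ : hc.core.TotalSpace)) (add_assoc _ _ _)

theorem proj_vadd (t : Torus n) (y : hc.core.TotalSpace) : (t +ᵥ y).proj = y.proj := rfl

theorem coord_vadd (α : ι) (t : Torus n) (y : hc.core.TotalSpace) :
    hc.coord α (t +ᵥ y) = t + hc.coord α y :=
  add_assoc t (hc.fibreComponent y) _

/-- The point of the glued bundle over `x` with fibre coordinate `t` over `V α`. -/
def point (α : ι) (x : X) (t : Torus n) : hc.core.TotalSpace :=
  (hc.core.localTriv α).toOpenPartialHomeomorph.symm (x, t)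

theorem proj_point {α : ι} {x : X} (hx : x ∈ V α) (t : Torus n) :
    (hc.point α x t).proj = x :=
  (hc.core.localTriv α).proj_symm_apply' hx

theorem coord_point {α : ι} {x : X} (hx : x ∈ V α) (t : Torus n) :
    hc.coord α (hc.point α x t) = t :=
  congrArg Prod.snd ((hc.core.localTriv α).apply_symm_apply' (x := t) hx)

theorem point_eq {α : ι} {y : hc.core.TotalSpace} (hy : y.proj ∈ V α) :
    hc.point α y.proj (hc.coord α y) = y :=
  (hc.core.localTriv α).toOpenPartialHomeomorph.left_inv hy

theorem continuous_proj :
    Continuous (Bundle.TotalSpace.proj : hc.core.TotalSpace → X) :=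
  FiberBundle.continuous_proj (Torus n) hc.core.Fiber

/-- Near `z` the map `f` is recovered by applying the inverse trivialization over `V α` to its
projection and coordinate. -/
theorem continuousAt_of_coord {N : Type*} [TopologicalSpace N] {f : N → hc.core.TotalSpace}
    {z : N} {α : ι} (hα : (f z).proj ∈ V α) (hp : ContinuousAt (fun w => (f w).proj) z)
    (ht : ContinuousAt (fun w => hc.coord α (f w)) z) : ContinuousAt f z := by
  have h1 : ContinuousAt (fun w => hc.point α (f w).proj (hc.coord α (f w))) z := by
    refine ContinuousAt.comp (f := fun w => ((f w).proj, hc.coord α (f w)))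
      (g := (hc.core.localTriv α).toOpenPartialHomeomorph.symm) ?_ (hp.prodMk ht)
    refine (hc.core.localTriv α).toOpenPartialHomeomorph.symm.continuousAt ?_
    exact ⟨hα, trivial⟩
  refine h1.congr ?_
  filter_upwards [hp.eventually ((hc.isOpen α).mem_nhds hα)] with w hw using hc.point_eq hw

/-- Charts of the glued bundle, built from a fibre coordinate, a chart of the base and a chart
of the torus. -/
def chart (i : ι × X × (Fin n → ℝ)) :
    OpenPartialHomeomorph hc.core.TotalSpace (ModelProd HX (Fin n → ℝ)) :=
  (hc.core.localTriv i.1).toOpenPartialHomeomorph.trans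
    ((chartAt HX i.2.1).prod (torusChart i.2.2))

variable {i : ι × X × (Fin n → ℝ)}

theorem mem_chart_source {y : hc.core.TotalSpace} : y ∈ (hc.chart i).source ↔
    y.proj ∈ V i.1 ∧ y.proj ∈ (chartAt HX i.2.1).source ∧
      hc.coord i.1 y ∈ (torusChart i.2.2).source := by
  rfl

theorem mem_chart_target {q : ModelProd HX (Fin n → ℝ)} : q ∈ (hc.chart i).target →
    q.1 ∈ (chartAt HX i.2.1).target ∧ (chartAt HX i.2.1).symm q.1 ∈ V i.1 :=
  fun h => ⟨h.1.1, h.2.1⟩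

theorem proj_chart_symm {q : ModelProd HX (Fin n → ℝ)} (hq : q ∈ (hc.chart i).target) :
    ((hc.chart i).symm q).proj = (chartAt HX i.2.1).symm q.1 :=
  hc.proj_point (hc.mem_chart_target hq).2 _

theorem coord_chart_symm {q : ModelProd HX (Fin n → ℝ)} (hq : q ∈ (hc.chart i).target) :
    hc.coord i.1 ((hc.chart i).symm q) = toTorus q.2 :=
  hc.coord_point (hc.mem_chart_target hq).2 _

/-- The index of the preferred chart at a point of the glued bundle. -/
def chartIndex (y : hc.core.TotalSpace) : ι × X × (Fin n → ℝ) :=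
  (hc.core.indexAt y.proj, y.proj,
    (exists_mem_torusChart_source (hc.coord (hc.core.indexAt y.proj) y)).choose)

theorem mem_chartIndex_source (y : hc.core.TotalSpace) :
    y ∈ (hc.chart (hc.chartIndex y)).source :=
  hc.mem_chart_source.2 ⟨hc.core.mem_baseSet_at y.proj, _root_.mem_chart_source HX y.proj,
    (exists_mem_torusChart_source (hc.coord (hc.core.indexAt y.proj) y)).choose_spec⟩

instance chartedSpace : ChartedSpace (ModelProd HX (Fin n → ℝ)) hc.core.TotalSpace where
  atlas := Set.range hc.chart
  chartAt y := hc.chart (hc.chartIndex y)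
  mem_chart_source y := hc.mem_chartIndex_source y
  chart_mem_atlas _ := ⟨_, rfl⟩

end IsTorusCocycle
end TorusCocycle

/-! ### Smooth structure of the glued bundle -/

section TorusCocycleManifold

variable {EX : Type*} [NormedAddCommGroup EX] [NormedSpace ℝ EX]
  {HX : Type*} [TopologicalSpace HX] {J : ModelWithCorners ℝ EX HX}
  {X : Type u} [TopologicalSpace X] [ChartedSpace HX X]
  {n : ℕ} {ι : Type*} {V : ι → Set X} {c : ι → ι → X → Torus n}

namespace IsTorusCocycle

variable (hc : IsTorusCocycle J V c)

/-- The base factor of the preferred chart at `y` is the preferred chart at `y.proj`, so the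
projection read in charts is the linear projection to `EX`. -/
theorem contMDiff_proj : ContMDiff (J.prod 𝓘(ℝ, Fin n → ℝ)) J ∞
    (Bundle.TotalSpace.proj : hc.core.TotalSpace → X) := by
  intro y
  rw [contMDiffAt_iff_target]
  refine ⟨hc.continuous_proj.continuousAt, ?_⟩
  exact (ContinuousLinearMap.fst ℝ EX (Fin n → ℝ)).contMDiff.contMDiffAt.comp y
    (contMDiffAt_extChartAt (I := J.prod 𝓘(ℝ, Fin n → ℝ)) (x := y))

/-- The preferred chart at `y` contains a lift of one coordinate, that of the preferred index; every
other coordinate differs from it by a smooth function `c β α` of the base point. -/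
theorem torusSmoothOn_coord (α : ι) : TorusSmoothOn (J.prod 𝓘(ℝ, Fin n → ℝ)) (hc.coord α)
    (Bundle.TotalSpace.proj ⁻¹' V α) := by
  intro y hy
  have hβ := hc.core.mem_baseSet_at y.proj
  set β := hc.core.indexAt y.proj with hβ'
  have h1 : IsSmoothLiftAt (J.prod 𝓘(ℝ, Fin n → ℝ)) (hc.coord β)
      (fun z => torusChart (hc.chartIndex y).2.2 (hc.coord β z)) y := by
    refine ⟨(ContinuousLinearMap.snd ℝ EX (Fin n → ℝ)).contMDiff.contMDiffAt.comp y
      (contMDiffAt_extChartAt (I := J.prod 𝓘(ℝ, Fin n → ℝ)) (x := y)), ?_⟩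
    filter_upwards [(hc.chart (hc.chartIndex y)).open_source.mem_nhds
      (hc.mem_chartIndex_source y)] with z hz
    exact (toTorus_torusChart (hc.mem_chart_source.1 hz).2.2).symm
  obtain ⟨g, hg⟩ := hc.smooth β α y.proj ⟨hβ, hy⟩
  refine ⟨_, (h1.add (hg.comp (hc.contMDiff_proj y))).congr ?_⟩
  filter_upwards [hc.continuous_proj.continuousAt.eventually ((hc.isOpen α).mem_nhds hy),
    hc.continuous_proj.continuousAt.eventually ((hc.isOpen β).mem_nhds hβ)] with z hz hz'
  exact hc.coord_eq hz' hz

/-- A transition map has two components: a transition map of the base, and a continuous lift of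
`toTorus r.2 + c`, which is smooth because that torus-valued map has a smooth lift. -/
theorem contMDiffOn_chart_symm_trans [IsManifold J ∞ X] (i j : ι × X × (Fin n → ℝ)) :
    ContMDiffOn (M' := HX × (Fin n → ℝ)) (J.prod 𝓘(ℝ, Fin n → ℝ)) (J.prod 𝓘(ℝ, Fin n → ℝ)) ∞
      (fun r : HX × (Fin n → ℝ) => hc.chart j ((hc.chart i).symm r))
      {r | r ∈ ((hc.chart i).symm.trans (hc.chart j)).source} := by
  intro q hq
  have hcont : ContinuousAt
      (fun r : HX × (Fin n → ℝ) => hc.chart j ((hc.chart i).symm r)) q :=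
    ((hc.chart i).symm.trans (hc.chart j)).continuousAt hq
  have hopen : {r : HX × (Fin n → ℝ) | r ∈ ((hc.chart i).symm.trans (hc.chart j)).source} ∈ 𝓝 q :=
    ((hc.chart i).symm.trans (hc.chart j)).open_source.mem_nhds hq
  have key : ∀ r : HX × (Fin n → ℝ), r ∈ ((hc.chart i).symm.trans (hc.chart j)).source →
      (hc.chart j ((hc.chart i).symm r)).1 =
        chartAt HX j.2.1 ((chartAt HX i.2.1).symm r.1) ∧
      toTorus (hc.chart j ((hc.chart i).symm r)).2 =
        toTorus r.2 + c i.1 j.1 ((chartAt HX i.2.1).symm r.1) := by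
    rintro r ⟨h1, h2⟩
    change r ∈ (hc.chart i).target at h1
    change (hc.chart i).symm r ∈ (hc.chart j).source at h2
    have hp := hc.proj_chart_symm h1
    obtain ⟨h3, -, h4⟩ := hc.mem_chart_source.1 h2
    constructor
    · exact congrArg (chartAt HX j.2.1) hp
    · refine (toTorus_torusChart h4).trans ?_
      rw [hc.coord_eq (α := i.1) (by rw [hp]; exact (hc.mem_chart_target h1).2) h3, hp,
        hc.coord_chart_symm h1]
  obtain ⟨h1, h2⟩ := hq
  change q ∈ (hc.chart i).target at h1
  change (hc.chart i).symm q ∈ (hc.chart j).source at h2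
  have hp := hc.proj_chart_symm h1
  obtain ⟨h3, h5, -⟩ := hc.mem_chart_source.1 h2
  rw [hp] at h3 h5
  have hs : ContMDiffAt (J.prod 𝓘(ℝ, Fin n → ℝ)) J ∞
      (fun r : HX × (Fin n → ℝ) => (chartAt HX i.2.1).symm r.1) q :=
    ContMDiffAt.comp q ((contMDiffOn_chart_symm (I := J) (x := i.2.1)).contMDiffAt
      ((chartAt HX i.2.1).open_target.mem_nhds (hc.mem_chart_target h1).1)) contMDiffAt_fst
  obtain ⟨g, hg⟩ := hc.smooth i.1 j.1 _ ⟨(hc.mem_chart_target h1).2, h3⟩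
  refine ContMDiffAt.contMDiffWithinAt ?_
  have f1 : ContMDiffAt (J.prod 𝓘(ℝ, Fin n → ℝ)) J ∞
      (fun r : HX × (Fin n → ℝ) => (hc.chart j ((hc.chart i).symm r)).1) q := by
    refine ContMDiffAt.congr_of_eventuallyEq (f :=
      fun r : HX × (Fin n → ℝ) => chartAt HX j.2.1 ((chartAt HX i.2.1).symm r.1)) ?_
      (Filter.mem_of_superset hopen fun r hr => (key r hr).1)
    exact ContMDiffAt.comp q ((contMDiffOn_chart (I := J) (x := j.2.1)).contMDiffAt
      ((chartAt HX j.2.1).open_source.mem_nhds h5)) hs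
  have f2 : ContMDiffAt (J.prod 𝓘(ℝ, Fin n → ℝ)) 𝓘(ℝ, Fin n → ℝ) ∞
      (fun r : HX × (Fin n → ℝ) => (hc.chart j ((hc.chart i).symm r)).2) q := by
    have hl := (IsSmoothLiftAt.toTorus_comp (contMDiffAt_snd (I := J)
      (J := 𝓘(ℝ, Fin n → ℝ)) (p := q))).add (hg.comp hs)
    refine contMDiffAt_of_toTorus_eq (continuous_snd.continuousAt.comp hcont) hl.1 ?_
    filter_upwards [hopen, hl.2] with r hr h6
    rw [← h6]
    exact (key r hr).2
  exact f1.prodMk f2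

instance isManifold [IsManifold J ∞ X] : IsManifold (J.prod 𝓘(ℝ, Fin n → ℝ)) ∞
    hc.core.TotalSpace := by
  refine isManifold_of_contDiffOn _ _ _ ?_
  rintro _ _ ⟨i, rfl⟩ ⟨j, rfl⟩
  have h := hc.contMDiffOn_chart_symm_trans i j
  rw [chartedSpaceSelf_prod] at h
  replace h : ContMDiffOn (M := ModelProd HX (Fin n → ℝ)) (M' := ModelProd HX (Fin n → ℝ))
    (J.prod 𝓘(ℝ, Fin n → ℝ)) (J.prod 𝓘(ℝ, Fin n → ℝ)) ∞
    (fun r => hc.chart j ((hc.chart i).symm r))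
    {r | r ∈ ((hc.chart i).symm.trans (hc.chart j)).source} := h
  rw [← contMDiffOn_iff_contDiffOn]
  exact (J.prod 𝓘(ℝ, Fin n → ℝ)).contMDiff.comp_contMDiffOn
    (h.comp ((J.prod 𝓘(ℝ, Fin n → ℝ)).contMDiffOn_symm.mono Set.inter_subset_right)
      fun _ hx => hx.1)

variable {EN : Type*} [NormedAddCommGroup EN] [NormedSpace ℝ EN] {HN : Type*} [TopologicalSpace HN]
  {IN : ModelWithCorners ℝ EN HN} {N : Type*} [TopologicalSpace N] [ChartedSpace HN N]

/-- A map into the glued bundle is smooth if its projection and its fibre coordinate are. -/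
theorem contMDiffAt_of_coord {f : N → hc.core.TotalSpace} {z : N} {α : ι}
    (hα : (f z).proj ∈ V α) (hp : ContMDiffAt IN J ∞ (fun w => (f w).proj) z)
    {g : N → Fin n → ℝ} (ht : IsSmoothLiftAt IN (fun w => hc.coord α (f w)) g z) :
    ContMDiffAt IN (J.prod 𝓘(ℝ, Fin n → ℝ)) ∞ f z := by
  have hf := hc.continuousAt_of_coord hα hp.continuousAt ht.continuousAt
  have hβ := hc.core.mem_baseSet_at (f z).proj
  set β := hc.core.indexAt (f z).proj with hβ'
  -- The hypothesis concerns the coordinate of index `α`, while the preferred chart at `f z` uses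
  -- `β`; a lift of `c α β` along the projection converts one into the other.
  obtain ⟨k, hk⟩ := hc.smooth α β (f z).proj ⟨hα, hβ⟩
  have hl := ht.add (hk.comp hp)
  have hsource := hf.eventually ((hc.chart (hc.chartIndex (f z))).open_source.mem_nhds
      (hc.mem_chartIndex_source (f z)))
  have h1 : ContMDiffAt IN 𝓘(ℝ, EX) ∞ (fun w => extChartAt J (f z).proj (f w).proj) z :=
    (contMDiffAt_extChartAt (I := J) (x := (f z).proj)).comp z hp
  rw [contMDiffAt_iff_target]
  refine ⟨hf, h1.prodMk_space (g := fun w => torusChart (hc.chartIndex (f z)).2.2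
    (hc.coord β (f w))) ?_⟩
  refine contMDiffAt_of_toTorus_eq (ContinuousAt.comp (f := f)
    (continuous_snd.continuousAt.comp
      ((hc.chart (hc.chartIndex (f z))).continuousAt (hc.mem_chartIndex_source (f z)))) hf)
    hl.1 ?_
  filter_upwards [hsource, hl.2, hp.continuousAt.eventually ((hc.isOpen α).mem_nhds hα)]
    with w h1 h2 h3
  obtain ⟨h4, -, h5⟩ := hc.mem_chart_source.1 h1
  rw [← h2]
  exact (toTorus_torusChart h5).trans (hc.coord_eq h3 h4)

end IsTorusCocycle

/-- A smooth torus-valued cocycle on an open cover is the gluing cocycle of a principal torus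
bundle with fibre coordinates. -/
theorem exists_isGluedTorusBundle [IsManifold J ∞ X] [T2Space X] [SecondCountableTopology X]
    (hc : IsTorusCocycle J V c) :
    ∃ (Y : Type u) (_ : TopologicalSpace Y) (_ : ChartedSpace (ModelProd HX (Fin n → ℝ)) Y)
      (_ : IsManifold (J.prod 𝓘(ℝ, Fin n → ℝ)) ∞ Y) (_ : AddAction (Torus n) Y)
      (p : Y → X) (θs : ι → Y → Torus n),
      T2Space Y ∧ SecondCountableTopology Y ∧
      IsGluedTorusBundle J (J.prod 𝓘(ℝ, Fin n → ℝ)) V c p θs := by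
  refine ⟨hc.core.TotalSpace, inferInstance, hc.chartedSpace, hc.isManifold, hc.addAction,
    Bundle.TotalSpace.proj, hc.coord, hc.core.t2Space_totalSpace,
    hc.core.secondCountableTopology_totalSpace, ?_, ?_, ?_⟩
  · refine ⟨hc.contMDiff_proj, ?_, hc.proj_vadd, ?_, ?_⟩
    · intro q
      have hα := hc.core.mem_baseSet_at q.2.proj
      have hp := (hc.contMDiff_proj (J := J)).contMDiffAt.comp q
        (contMDiffAt_snd (I := 𝓘(ℝ, Fin n → ℝ)) (J := J.prod 𝓘(ℝ, Fin n → ℝ)) (p := q))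
      obtain ⟨g, hg⟩ := hc.torusSmoothOn_coord (J := J) _ q.2 hα
      exact hc.contMDiffAt_of_coord (f := fun q : (Fin n → ℝ) × hc.core.TotalSpace =>
        toTorus q.1 +ᵥ q.2) (α := hc.core.indexAt q.2.proj) hα hp
        (((IsSmoothLiftAt.toTorus_comp contMDiffAt_fst).add (hg.comp contMDiffAt_snd)).congr
          (Filter.Eventually.of_forall fun w => hc.coord_vadd _ _ w.2))
    · intro q q' hqq
      have hα := hc.core.mem_baseSet_at q.proj
      set α := hc.core.indexAt q.proj
      have hα' : q'.proj ∈ V α := hqq ▸ hα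
      refine ⟨hc.coord α q' - hc.coord α q, ?_, fun t ht => ?_⟩
      · have h1 : ((hc.coord α q' - hc.coord α q) +ᵥ q).proj ∈ V α := hα
        change _ +ᵥ q = q'
        rw [← hc.point_eq h1, hc.coord_vadd, hc.proj_vadd, sub_add_cancel, hqq, hc.point_eq hα']
      · rw [← ht, hc.coord_vadd, add_sub_cancel_right]
    · intro x
      obtain ⟨α, hα⟩ := hc.exists_mem x
      refine ⟨V α, fun x => hc.point α x 0, hc.isOpen α, hα, ?_,
        fun x' hx' => hc.proj_point hx' _⟩
      intro x' hx'
      refine ContMDiffAt.contMDiffWithinAt ?_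
      have hn := (hc.isOpen α).mem_nhds hx'
      refine hc.contMDiffAt_of_coord (α := α) (g := fun _ => 0)
        (by rwa [hc.proj_point hx']) (contMDiffAt_id.congr_of_eventuallyEq
          (Filter.mem_of_superset hn fun x'' h => hc.proj_point h _))
        ⟨contMDiffAt_const, Filter.mem_of_superset hn fun x'' h => ?_⟩
      exact hc.coord_point h _
  · exact fun α => ⟨hc.torusSmoothOn_coord α, fun t q _ => hc.coord_vadd α t q⟩
  · exact fun α β q hq => hc.coord_sub_coord hq.1 hq.2

end TorusCocycleManifold

/-! ### The functions `lamSharp` form a torus cocycle -/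

section Gerbe

variable {E : Type*} [NormedAddCommGroup E] [NormedSpace ℝ E]
  {H : Type*} [TopologicalSpace H] {I : ModelWithCorners ℝ E H}
  {EX : Type*} [NormedAddCommGroup EX] [NormedSpace ℝ EX]
  {HX : Type*} [TopologicalSpace HX] {J : ModelWithCorners ℝ EX HX}
  {M : Type*} [TopologicalSpace M] [ChartedSpace H M] [IsManifold I ∞ M]
  {X : Type u} [TopologicalSpace X] [ChartedSpace HX X] [IsManifold J ∞ X]
  {n : ℕ} [AddAction (Torus n) X] {ι : Type*}
  {U : ι → Set M} {lam : ι → ι → M → Fin n → ℝ}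
  {A : ι → ∀ x : M, TangentSpace I x →L[ℝ] (Fin n → ℝ)}
  {π : X → M} {θ : ι → X → Torus n}
  {Θ : ∀ x : X, TangentSpace J x →L[ℝ] (Fin n → ℝ)}
  {m : ι → ι → M → Matrix (Fin n) (Fin n) ℤ} {h : ι → ι → M → Fin n → ℝ}
  {B₀ : ι → M → Matrix (Fin n) (Fin n) ℝ}
  {B₁ : ι → ∀ x : M, TangentSpace I x →L[ℝ] (Fin n → ℝ)}

theorem realMatrix_add (a b : Matrix (Fin n) (Fin n) ℤ) :
    realMatrix (a + b) = realMatrix a + realMatrix b := by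
  ext i j; simp [realMatrix]

theorem realMatrix_zero : realMatrix (0 : Matrix (Fin n) (Fin n) ℤ) = 0 := by
  ext i j; simp [realMatrix]

namespace IsInvariantGerbe

variable (hB : IsInvariantGerbe I U lam A m h B₀ B₁)
include hB

theorem m_self {α : ι} {x : M} (hx : x ∈ U α) : m α α x = 0 := by
  have h1 := hB.m_cocycle α α α x ⟨⟨hx, hx⟩, hx⟩
  ext i j
  have h2 := congrFun (congrFun h1 i) j
  simp only [Matrix.add_apply, Matrix.zero_apply] at h2 ⊢
  omega

theorem m_symm {α β : ι} {x : M} (hα : x ∈ U α) (hβ : x ∈ U β) : m β α x = -m α β x := by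
  have h1 := hB.m_cocycle α β α x ⟨⟨hα, hβ⟩, hα⟩
  rw [hB.m_self hα, add_zero] at h1
  exact (neg_eq_of_add_eq_zero_right h1).symm

theorem h_self {α : ι} {x : M} (hx : x ∈ U α) : h α α x = 0 :=
  self_eq_neg.1 (hB.h_skew α α x ⟨hx, hx⟩)

/-- The integral matrices `m α β` are locally constant, as differences of continuous functions. -/
theorem m_eventually_eq (hU : ∀ α, IsOpen (U α)) {α β : ι} {x : M} (hα : x ∈ U α) (hβ : x ∈ U β) :
    ∀ᶠ y in 𝓝 x, m α β y = m α β x := by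
  have hentry : ∀ i j, ∀ᶠ y in 𝓝 x, m α β y i j = m α β x i j := by
    intro i j
    have hc : ContinuousAt (fun y => B₀ α y i j - B₀ β y i j) x :=
      ((hB.B₀_smooth α i j).contMDiffAt ((hU α).mem_nhds hα)).continuousAt.sub
        ((hB.B₀_smooth β i j).contMDiffAt ((hU β).mem_nhds hβ)).continuousAt
    filter_upwards [(Metric.tendsto_nhds.1 hc) 1 one_pos, (hU α).mem_nhds hα, (hU β).mem_nhds hβ]
      with y h1 h2 h3
    have e : ∀ z, z ∈ U α → z ∈ U β → B₀ α z i j - B₀ β z i j = (m α β z i j : ℝ) :=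
      fun z h4 h5 => congrFun (congrFun (hB.B₀_gluing α β z ⟨h4, h5⟩) i) j
    rw [e y h2 h3, e x hα hβ, Real.dist_eq] at h1
    have h6 : |m α β y i j - m α β x i j| < 1 := by exact_mod_cast h1
    have := Int.abs_lt_one_iff.1 h6
    omega
  filter_upwards [Filter.eventually_all.2 fun i => Filter.eventually_all.2 (hentry i)] with y hy
  exact Matrix.ext hy

end IsInvariantGerbe

omit [TopologicalSpace X] [ChartedSpace HX X] [IsManifold J ∞ X] [AddAction (Torus n) X] in
-- Both `m α α` and `h α α` vanish, so the diagonal value of `lam` does not contribute.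
theorem lamSharp_self (hB : IsInvariantGerbe I U lam A m h B₀ B₁)
    {α : ι} {x : X} (hα : π x ∈ U α) : lamSharp lam m h π θ α α x = 0 := by
  obtain ⟨t, ht⟩ := toTorus_surjective (θ α x)
  rw [lamSharp, hB.m_self hα, hB.h_self hα, ← ht, Torus.mulVec_toTorus]
  simp [realMatrix_zero, toTorus_zero]

variable (hX : IsLocalTorusBundle I J U lam A π θ Θ) (hB : IsInvariantGerbe I U lam A m h B₀ B₁)
include hX hB

omit hB in
theorem IsLocalTorusBundle.contMDiffAt_lam_comp {α β : ι} {x : X} (hα : π x ∈ U α)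
    (hβ : π x ∈ U β) : ContMDiffAt J 𝓘(ℝ, Fin n → ℝ) ∞ (fun y => lam α β (π y)) x :=
  ((hX.lam_smooth α β).contMDiffAt (((hX.isOpen α).inter (hX.isOpen β)).mem_nhds ⟨hα, hβ⟩)).comp x
    (hX.glued.principal.smooth_proj x)

theorem IsInvariantGerbe.contMDiffAt_h_comp {α β : ι} {x : X} (hα : π x ∈ U α)
    (hβ : π x ∈ U β) : ContMDiffAt J 𝓘(ℝ, Fin n → ℝ) ∞ (fun y => h α β (π y)) x :=
  ((hB.h_smooth α β).contMDiffAt (((hX.isOpen α).inter (hX.isOpen β)).mem_nhds ⟨hα, hβ⟩)).comp x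
    (hX.glued.principal.smooth_proj x)

/-- A smooth lift of `lamSharp` obtained from one of the fibre coordinate `θ β`. -/
theorem isSmoothLiftAt_lamSharp {α β : ι} {x : X} (hα : π x ∈ U α) (hβ : π x ∈ U β)
    {g : X → Fin n → ℝ} (hg : IsSmoothLiftAt J (θ β) g x) :
    IsSmoothLiftAt J (lamSharp lam m h π θ α β)
      (fun y => h α β (π y) - (realMatrix (m α β (π x)) *ᵥ g y +
        ((1 / 2 : ℝ) • realMatrix (m α β (π x))) *ᵥ lam β α (π y))) x := by
  have hm : ∀ᶠ y in 𝓝 x, m α β (π y) = m α β (π x) :=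
    (hX.glued.principal.smooth_proj x).continuousAt.eventually (hB.m_eventually_eq hX.isOpen hα hβ)
  refine ((IsSmoothLiftAt.toTorus_comp (hB.contMDiffAt_h_comp hX hα hβ)).sub
    ((hg.mulVec hm).add (IsSmoothLiftAt.toTorus_comp
      ((hX.contMDiffAt_lam_comp hβ hα).mulVec ((1 / 2 : ℝ) • realMatrix (m α β (π x))))))).congr ?_
  filter_upwards [hm] with y hy
  rw [lamSharp, hy, Matrix.smul_mulVec]

theorem torusSmoothOn_lamSharp (α β : ι) :
    TorusSmoothOn J (lamSharp lam m h π θ α β) (π ⁻¹' (U α ∩ U β)) := fun x hx =>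
  let ⟨_, hg⟩ := (hX.glued.coordinate β).smooth x hx.2
  ⟨_, isSmoothLiftAt_lamSharp hX hB hx.1 hx.2 hg⟩

/-- All three coordinates are lifted relative to a single lift `t` of `θ β x`. The `t` terms cancel
by the cocycle condition for `m`, and the half-integral terms in `h_cocycle` are those needed to
cancel the rest. -/
theorem lamSharp_cocycle (α β γ : ι) (x : X) (hx : π x ∈ U α ∩ U β ∩ U γ) :
    lamSharp lam m h π θ α β x + lamSharp lam m h π θ β γ x + lamSharp lam m h π θ γ α x = 0 := by
  obtain ⟨⟨hα, hβ⟩, hγ⟩ := hx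
  obtain ⟨t, ht⟩ := toTorus_surjective (θ β x)
  have hθγ : θ γ x = toTorus (t + lam β γ (π x)) := by
    have := hX.glued.gluing β γ x ⟨hβ, hγ⟩
    rw [toTorus_add, ht, ← neg_neg (toTorus (lam β γ _)), ← this]
    abel
  have hθα : θ α x = toTorus (t - lam α β (π x)) := by
    have := hX.glued.gluing α β x ⟨hα, hβ⟩
    rw [toTorus_sub, ht, sub_eq_add_neg, ← this]
    abel
  -- Eliminating `m α β` leaves `m β γ` and `m γ α` as the only matrices, so that the final identity
  -- is linear in independent terms.
  have hm : realMatrix (m α β (π x)) = -realMatrix (m β γ (π x)) - realMatrix (m γ α (π x)) := by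
    have := congrArg realMatrix (hB.m_cocycle α β γ (π x) ⟨⟨hα, hβ⟩, hγ⟩)
    rw [realMatrix_add, realMatrix_add, realMatrix_zero] at this
    rw [← sub_eq_zero, ← this]
    abel
  have hm' : realMatrix (m γ β (π x)) = -realMatrix (m β γ (π x)) := by
    rw [hB.m_symm hβ hγ]
    ext i j
    simp [realMatrix]
  have hh := hB.h_cocycle α β γ (π x) ⟨⟨hα, hβ⟩, hγ⟩
  have l1 := hX.lam_skew α β (π x) ⟨hα, hβ⟩
  have l2 := hX.lam_skew β γ (π x) ⟨hβ, hγ⟩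
  have l3 := hX.lam_skew γ α (π x) ⟨hγ, hα⟩
  have e : ∀ a₁ a₂ a₃ b₁ b₂ b₃ : Torus n,
      (a₁ - b₁) + (a₂ - b₂) + (a₃ - b₃) = (a₁ + a₂ + a₃) - (b₁ + b₂ + b₃) := by
    intros; abel
  rw [lamSharp, lamSharp, lamSharp, ← ht, hθγ, hθα, Torus.mulVec_toTorus, Torus.mulVec_toTorus,
    Torus.mulVec_toTorus, e, ← toTorus_add, ← toTorus_add, hh]
  simp only [← toTorus_add, ← toTorus_sub]
  rw [← toTorus_zero]
  -- The representatives now agree in `ℝⁿ` itself, not merely modulo `ℤⁿ`.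
  congr 1
  rw [hm, hm', l1, l2, l3]
  simp only [Matrix.sub_mulVec, Matrix.neg_mulVec, Matrix.mulVec_add, Matrix.mulVec_sub,
    Matrix.mulVec_neg]
  module

theorem isTorusCocycle_lamSharp :
    IsTorusCocycle J (fun α => π ⁻¹' U α) (lamSharp lam m h π θ) where
  isOpen α := (hX.isOpen α).preimage hX.glued.principal.smooth_proj.continuous
  cover := by rw [← Set.preimage_iUnion, hX.cover, Set.preimage_univ]
  smooth := torusSmoothOn_lamSharp hX hB
  self_eq_zero _ _ hx := lamSharp_self hB hx
  cocycle α β γ x hx := lamSharp_cocycle hX hB α β γ x hx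

end Gerbe

/-! ### Differentials and smooth vector-valued one-forms -/

section Forms

variable {E : Type*} [NormedAddCommGroup E] [NormedSpace ℝ E] {H : Type*} [TopologicalSpace H]
  {I : ModelWithCorners ℝ E H} {P : Type*} [TopologicalSpace P] [ChartedSpace H P] {n : ℕ}
  {E' : Type*} [NormedAddCommGroup E'] [NormedSpace ℝ E'] {H' : Type*} [TopologicalSpace H']
  {I' : ModelWithCorners ℝ E' H'} {P' : Type*} [TopologicalSpace P'] [ChartedSpace H' P']
  {f g : P → Fin n → ℝ} {θ η : P → Torus n} {x : P}

theorem hasMFDerivAt_vecDiff (hf : ContMDiffAt I 𝓘(ℝ, Fin n → ℝ) ∞ f x) :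
    HasMFDerivAt I 𝓘(ℝ, Fin n → ℝ) f x (vecDiff I f x) :=
  (hf.mdifferentiableAt (by simp)).hasMFDerivAt

theorem vecDiff_add (hf : ContMDiffAt I 𝓘(ℝ, Fin n → ℝ) ∞ f x)
    (hg : ContMDiffAt I 𝓘(ℝ, Fin n → ℝ) ∞ g x) (v : TangentSpace I x) :
    vecDiff I (fun y => f y + g y) x v = vecDiff I f x v + vecDiff I g x v :=
  DFunLike.congr_fun ((hasMFDerivAt_vecDiff hf).add (hasMFDerivAt_vecDiff hg)).mfderiv v

theorem vecDiff_sub (hf : ContMDiffAt I 𝓘(ℝ, Fin n → ℝ) ∞ f x)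
    (hg : ContMDiffAt I 𝓘(ℝ, Fin n → ℝ) ∞ g x) (v : TangentSpace I x) :
    vecDiff I (fun y => f y - g y) x v = vecDiff I f x v - vecDiff I g x v :=
  DFunLike.congr_fun ((hasMFDerivAt_vecDiff hf).sub (hasMFDerivAt_vecDiff hg)).mfderiv v

theorem vecDiff_const (a : Fin n → ℝ) (v : TangentSpace I x) :
    vecDiff I (fun _ : P => a) x v = 0 :=
  DFunLike.congr_fun (hasMFDerivAt_const (I := I) (I' := 𝓘(ℝ, Fin n → ℝ)) a x).mfderiv v

theorem vecDiff_mulVec (b : Matrix (Fin n) (Fin n) ℝ)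
    (hf : ContMDiffAt I 𝓘(ℝ, Fin n → ℝ) ∞ f x) (v : TangentSpace I x) :
    vecDiff I (fun y => b *ᵥ f y) x v = b *ᵥ vecDiff I f x v :=
  DFunLike.congr_fun (b.mulVecLin.toContinuousLinearMap.hasMFDerivAt.comp x
    (hasMFDerivAt_vecDiff hf)).mfderiv v

theorem vecDiff_comp {φ : P' → P} {y : P'} (hf : ContMDiffAt I 𝓘(ℝ, Fin n → ℝ) ∞ f (φ y))
    (hφ : ContMDiffAt I' I ∞ φ y) (v : TangentSpace I' y) :
    vecDiff I' (fun z => f (φ z)) y v = vecDiff I f (φ y) (mfderiv I' I φ y v) :=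
  DFunLike.congr_fun ((hasMFDerivAt_vecDiff hf).comp y
    (hφ.mdifferentiableAt (by simp)).hasMFDerivAt).mfderiv v

theorem torusDiff_congr (hf : IsSmoothLiftAt I θ f x) (h : η =ᶠ[𝓝 x] θ) (v : TangentSpace I x) :
    torusDiff I η x v = torusDiff I θ x v := by
  rw [torusDiff_eq I hf, torusDiff_eq I (hf.congr h)]

theorem torusDiff_add (hf : IsSmoothLiftAt I θ f x) (hg : IsSmoothLiftAt I η g x)
    (v : TangentSpace I x) :
    torusDiff I (fun y => θ y + η y) x v = torusDiff I θ x v + torusDiff I η x v := by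
  rw [torusDiff_eq I hf, torusDiff_eq I hg, torusDiff_eq I (hf.add hg), vecDiff_add hf.1 hg.1]

theorem torusDiff_sub (hf : IsSmoothLiftAt I θ f x) (hg : IsSmoothLiftAt I η g x)
    (v : TangentSpace I x) :
    torusDiff I (fun y => θ y - η y) x v = torusDiff I θ x v - torusDiff I η x v := by
  rw [torusDiff_eq I hf, torusDiff_eq I hg, torusDiff_eq I (hf.sub hg), vecDiff_sub hf.1 hg.1]

theorem isSmoothLiftAt_const (a : Fin n → ℝ) :
    IsSmoothLiftAt I (fun _ : P => toTorus a) (fun _ => a) x :=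
  IsSmoothLiftAt.toTorus_comp contMDiffAt_const

theorem torusDiff_const (t : Torus n) (v : TangentSpace I x) :
    torusDiff I (fun _ : P => t) x v = 0 := by
  obtain ⟨a, rfl⟩ := toTorus_surjective t
  rw [torusDiff_eq I (isSmoothLiftAt_const a), vecDiff_const]

theorem torusDiff_comp {φ : P' → P} {y : P'} (hf : IsSmoothLiftAt I θ f (φ y))
    (hφ : ContMDiffAt I' I ∞ φ y) (v : TangentSpace I' y) :
    torusDiff I' (fun z => θ (φ z)) y v = torusDiff I θ (φ y) (mfderiv I' I φ y v) := by
  rw [torusDiff_eq I hf, torusDiff_eq I' (hf.comp hφ), vecDiff_comp hf.1 hφ]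

/-- A smooth torus-valued map on an open set has, near each point, a lift smooth on an open set. -/
theorem TorusSmoothOn.exists_contMDiffOn [IsManifold I ∞ P] {s : Set P}
    (h : TorusSmoothOn I θ s) (hs : IsOpen s) (hx : x ∈ s) :
    ∃ (g : P → Fin n → ℝ) (W : Set P), IsOpen W ∧ x ∈ W ∧ W ⊆ s ∧
      ContMDiffOn I 𝓘(ℝ, Fin n → ℝ) ∞ g W ∧ ∀ y ∈ W, θ y = toTorus (g y) := by
  obtain ⟨g, hg, hθ⟩ := h x hx
  have : IsManifold I 1 P := IsManifold.of_le (n := ∞) (by simp)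
  -- Smoothness of order `∞` at a point need not persist nearby, but order 1 does. This gives
  -- continuity of `g` near `x`, and comparison with the smooth lift available at each nearby point
  -- restores order `∞`.
  have h1 : ∀ᶠ y in 𝓝 x, ContMDiffAt I 𝓘(ℝ, Fin n → ℝ) 1 g y :=
    (contMDiffAt_iff_contMDiffAt_nhds (by simp)).1 (hg.of_le (by simp))
  obtain ⟨W, hW, hWo, hxW⟩ := mem_nhds_iff.1 (Filter.inter_mem (hs.mem_nhds hx)
    (Filter.inter_mem hθ h1))
  refine ⟨g, W, hWo, hxW, fun y hy => (hW hy).1, fun y hy => ?_, fun y hy => (hW hy).2.1⟩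
  obtain ⟨k, hk⟩ := h y (hW hy).1
  refine (contMDiffAt_of_toTorus_eq (hW hy).2.2.continuousAt hk.1 ?_).contMDiffWithinAt
  filter_upwards [hk.2, hWo.mem_nhds hy] with z h2 h3
  rw [← h2]
  exact (hW h3).2.1.symm

namespace SmoothFormOn

variable [IsManifold I ∞ P] [IsManifold I' ∞ P']
  {F : Type*} [NormedAddCommGroup F] [NormedSpace ℝ F] {s : Set P}
  {ζ ζ' : ∀ x : P, TangentSpace I x →L[ℝ] F}

theorem congr (h : SmoothFormOn I s ζ) (e : ∀ x ∈ s, ∀ v, ζ' x v = ζ x v) :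
    SmoothFormOn I s ζ' :=
  ContMDiffOn.congr h fun v hv => e v.1 hv v.2

theorem mono {t : Set P} (h : SmoothFormOn I s ζ) (hts : t ⊆ s) : SmoothFormOn I t ζ :=
  ContMDiffOn.mono h fun _ hv => hts hv

theorem add (h : SmoothFormOn I s ζ) (h' : SmoothFormOn I s ζ') :
    SmoothFormOn I s (fun x => ζ x + ζ' x) :=
  ContMDiffOn.add h h'

theorem sub (h : SmoothFormOn I s ζ) (h' : SmoothFormOn I s ζ') :
    SmoothFormOn I s (fun x => ζ x - ζ' x) :=
  ContMDiffOn.sub h h'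

theorem of_locally (h : ∀ x ∈ s, ∃ W, IsOpen W ∧ x ∈ W ∧ SmoothFormOn I W ζ) :
    SmoothFormOn I s ζ := by
  intro v hv
  obtain ⟨W, hW, hx, hζ⟩ := h v.1 hv
  have hn : {w : TangentBundle I P | w.1 ∈ W} ∈ 𝓝 v :=
    (FiberBundle.continuous_proj E (TangentSpace I)).continuousAt (hW.mem_nhds hx)
  exact (ContMDiffOn.contMDiffAt hζ hn).contMDiffWithinAt

/-- The pullback of a smooth form under a smooth map. -/
theorem pullback {φ : P' → P} (hφ : ContMDiff I' I ∞ φ) (h : SmoothFormOn I s ζ) :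
    SmoothFormOn I' (φ ⁻¹' s) (fun y => (ζ (φ y)).comp (mfderiv I' I φ y)) := by
  have : IsManifold I 1 P := IsManifold.of_le (n := ∞) (by simp)
  have : IsManifold I' 1 P' := IsManifold.of_le (n := ∞) (by simp)
  have ht : ContMDiff I'.tangent I.tangent ∞ (tangentMap I' I φ) :=
    hφ.contMDiff_tangentMap (by simp)
  exact ContMDiffOn.comp (t := {v : TangentBundle I P | v.1 ∈ s}) h ht.contMDiffOn
    fun v hv => hv

/-- On the tangent bundle, `df` is the fibre component of the tangent map of `f`. -/
theorem vecDiff (hs : IsOpen s) (hf : ContMDiffOn I 𝓘(ℝ, Fin n → ℝ) ∞ f s) :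
    SmoothFormOn I s (vecDiff I f) := by
  have : IsManifold I 1 P := IsManifold.of_le (n := ∞) (by simp)
  have ht := hf.contMDiffOn_tangentMapWithin (m := ∞) (by simp) hs.uniqueMDiffOn
  refine (((contMDiff_snd_tangentBundle_modelSpace (Fin n → ℝ)
    𝓘(ℝ, Fin n → ℝ)).comp_contMDiffOn ht).congr fun v hv => ?_)
  simp only [Function.comp, tangentMapWithin, _root_.vecDiff]
  rw [mfderivWithin_of_isOpen hs hv]
  rfl

theorem torusDiff (hs : IsOpen s) (hθ : TorusSmoothOn I θ s) :
    SmoothFormOn I s (torusDiff I θ) := by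
  refine of_locally fun x hx => ?_
  obtain ⟨g, W, hW, hxW, -, hg, hθg⟩ := hθ.exists_contMDiffOn hs hx
  refine ⟨W, hW, hxW, (SmoothFormOn.vecDiff hW hg).congr fun y hy v => ?_⟩
  rw [torusDiff_eq I ⟨hg.contMDiffAt (hW.mem_nhds hy), Filter.mem_of_superset (hW.mem_nhds hy) hθg⟩]

theorem mulVec {b : P → Matrix (Fin n) (Fin n) ℝ}
    {ζ : ∀ x : P, TangentSpace I x →L[ℝ] (Fin n → ℝ)}
    (hb : ∀ i j, ContMDiffOn I 𝓘(ℝ, ℝ) ∞ (fun x => b x i j) s) (h : SmoothFormOn I s ζ) :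
    SmoothFormOn I s (fun x => (b x).mulVecLin.toContinuousLinearMap.comp (ζ x)) := by
  refine contMDiffOn_pi_space.2 fun i => ?_
  have h1 := contMDiffOn_pi_space.1 h
  have hp : ContMDiff I.tangent I ∞ (fun v : TangentBundle I P => v.1) :=
    Bundle.contMDiff_proj (TangentSpace I)
  refine contMDiffOn_finsetSum (t := Finset.univ)
    (f := fun j (v : TangentBundle I P) => b v.1 i j * ζ v.1 v.2 j) fun j _ => ?_
  exact ((hb i j).comp hp.contMDiffOn fun v hv => hv).mul (h1 j)

end SmoothFormOn

end Forms

/-! ### Gluing local forms to a connection -/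

section Connection

variable {EX : Type*} [NormedAddCommGroup EX] [NormedSpace ℝ EX]
  {HX : Type*} [TopologicalSpace HX] {J : ModelWithCorners ℝ EX HX}
  {X : Type u} [TopologicalSpace X] [ChartedSpace HX X]
  {EY : Type*} [NormedAddCommGroup EY] [NormedSpace ℝ EY]
  {HY : Type*} [TopologicalSpace HY] {K : ModelWithCorners ℝ EY HY}
  {Y : Type*} [TopologicalSpace Y] [ChartedSpace HY Y]
  {n : ℕ} [AddAction (Torus n) Y] {ι : Type*}
  {V : ι → Set X} {c : ι → ι → X → Torus n} {p : Y → X} {θs : ι → Y → Torus n}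

/-- Evaluation of the pullback of a form on `X` depends only on the composite map. -/
theorem form_mfderiv_comp {Z : Type*} [TopologicalSpace Z] {EZ : Type*} [NormedAddCommGroup EZ]
    [NormedSpace ℝ EZ] {HZ : Type*} [TopologicalSpace HZ] {L : ModelWithCorners ℝ EZ HZ}
    [ChartedSpace HZ Z] {F : Type*} [NormedAddCommGroup F] [NormedSpace ℝ F]
    (ζ : ∀ x : X, TangentSpace J x →L[ℝ] F) {φ : Z → Y} {ψ : Z → X} (hp : ContMDiff K J ∞ p)
    {z : Z} (hφ : ContMDiffAt L K ∞ φ z) (h : ∀ w, p (φ w) = ψ w) (v : TangentSpace L z) :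
    ζ (p (φ z)) (mfderiv K J p (φ z) (mfderiv L K φ z v)) = ζ (ψ z) (mfderiv L J ψ z v) := by
  obtain rfl : p ∘ φ = ψ := funext h
  rw [mfderiv_comp z ((hp _).mdifferentiableAt (by simp)) (hφ.mdifferentiableAt (by simp))]
  rfl

theorem IsPrincipalTorusBundle.contMDiff_vadd (h : IsPrincipalTorusBundle (n := n) J K p)
    (t : Torus n) : ContMDiff K K ∞ (fun q : Y => t +ᵥ q) := by
  obtain ⟨a, rfl⟩ := toTorus_surjective t
  exact h.smooth_action.comp (contMDiff_const.prodMk contMDiff_id)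

theorem IsPrincipalTorusBundle.contMDiff_orbit (h : IsPrincipalTorusBundle (n := n) J K p)
    (q : Y) : ContMDiff 𝓘(ℝ, Fin n → ℝ) K ∞ (fun s : Fin n → ℝ => toTorus s +ᵥ q) :=
  h.smooth_action.comp (contMDiff_id.prodMk contMDiff_const)

/-- The form `dθs + p^* ζ` in which `θs` is a fibre coordinate. -/
def coordForm (J : ModelWithCorners ℝ EX HX) (K : ModelWithCorners ℝ EY HY) (p : Y → X)
    (θ : Y → Torus n) (ζ : ∀ x : X, TangentSpace J x →L[ℝ] (Fin n → ℝ)) (y : Y) :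
    TangentSpace K y →L[ℝ] (Fin n → ℝ) :=
  torusDiff K θ y + (ζ (p y)).comp (mfderiv K J p y)

omit [AddAction (Torus n) Y] in
theorem coordForm_apply (θ : Y → Torus n) (ζ : ∀ x : X, TangentSpace J x →L[ℝ] (Fin n → ℝ))
    (y : Y) (v : TangentSpace K y) :
    coordForm J K p θ ζ y v = torusDiff K θ y v + ζ (p y) (mfderiv K J p y v) := rfl

variable [IsManifold J ∞ X] [IsManifold K ∞ Y]

/-- Forms `ζ α` on the base whose differences are `dc α β` define a connection equal to
`dθs α + p^* ζ α` over `V α`. -/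
theorem IsGluedTorusBundle.exists_connection (hG : IsGluedTorusBundle J K V c p θs)
    (hc : IsTorusCocycle J V c) {ζ : ι → ∀ x : X, TangentSpace J x →L[ℝ] (Fin n → ℝ)}
    (hζ : ∀ α, SmoothFormOn J (V α) (ζ α))
    (hglue : ∀ α β, ∀ x ∈ V α ∩ V β, ∀ w, ζ α x w - ζ β x w = torusDiff J (c α β) x w) :
    ∃ Θs : ∀ y : Y, TangentSpace K y →L[ℝ] (Fin n → ℝ), IsTorusConnection (n := n) K Θs ∧
      ∀ α y, p y ∈ V α → ∀ v, Θs y v = coordForm J K p (θs α) (ζ α) y v := by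
  have hp := hG.principal.smooth_proj
  have hVo : ∀ α, IsOpen (p ⁻¹' V α) := fun α => (hc.isOpen α).preimage hp.continuous
  -- The index may vary arbitrarily with `y`; `hind` below shows that the value of the form does not
  -- depend on it.
  choose i hi using fun y => hc.exists_mem (p y)
  have hind : ∀ α β y, p y ∈ V α → p y ∈ V β → ∀ v,
      coordForm J K p (θs α) (ζ α) y v = coordForm J K p (θs β) (ζ β) y v := by
    intro α β y hα hβ v
    obtain ⟨k, hk⟩ := (hG.coordinate β).smooth y hβ
    obtain ⟨l, hl⟩ := hc.smooth α β (p y) ⟨hα, hβ⟩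
    have e : θs α =ᶠ[𝓝 y] fun z => θs β z - c α β (p z) := by
      filter_upwards [(hVo α).mem_nhds hα, (hVo β).mem_nhds hβ] with z h1 h2
      rw [sub_eq_add_neg, ← hG.gluing α β z ⟨h1, h2⟩]
      abel
    rw [coordForm_apply, coordForm_apply, torusDiff_congr (hk.sub (hl.comp (hp y))) e,
      torusDiff_sub hk (hl.comp (hp y)), torusDiff_comp hl (hp y), ← hglue α β (p y) ⟨hα, hβ⟩]
    abel
  have hloc : ∀ α y, p y ∈ V α → ∀ v,
      coordForm J K p (θs (i y)) (ζ (i y)) y v = coordForm J K p (θs α) (ζ α) y v :=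
    fun α y hα v => hind _ _ y (hi y) hα v
  refine ⟨fun y => coordForm J K p (θs (i y)) (ζ (i y)) y, ⟨?_, ?_, ?_⟩, hloc⟩
  · refine SmoothFormOn.of_locally fun y _ => ⟨p ⁻¹' V (i y), hVo _, hi y, ?_⟩
    exact ((SmoothFormOn.torusDiff (hVo _) (hG.coordinate (i y)).smooth).add
      ((hζ (i y)).pullback hp)).congr fun z hz v => hloc (i y) z hz v
  · intro q v
    have hF := hG.principal.contMDiff_orbit q
    have hα : p (toTorus (0 : Fin n → ℝ) +ᵥ q) ∈ V (i q) := by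
      rw [hG.principal.proj_vadd]; exact hi q
    obtain ⟨k, hk⟩ := (hG.coordinate (i q)).smooth _ hα
    obtain ⟨a, ha⟩ := toTorus_surjective (θs (i q) q)
    -- Along an orbit the fibre coordinate is a translation of `s`, so `dθs` returns `v`, while the
    -- projection is constant and the pulled back form contributes zero.
    have e : (fun s : Fin n → ℝ => θs (i q) (toTorus s +ᵥ q)) = fun s => toTorus (s + a) := by
      funext s
      rw [(hG.coordinate (i q)).equivariant _ _ (hi q), ← ha, toTorus_add]
    have hid : ContMDiffAt 𝓘(ℝ, Fin n → ℝ) 𝓘(ℝ, Fin n → ℝ) ∞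
      (fun s : Fin n → ℝ => s) 0 := contMDiffAt_id
    have h1 : ∀ v : TangentSpace 𝓘(ℝ, Fin n → ℝ) (0 : Fin n → ℝ),
        torusDiff K (θs (i q)) (toTorus (0 : Fin n → ℝ) +ᵥ q)
          (mfderiv 𝓘(ℝ, Fin n → ℝ) K (fun s : Fin n → ℝ => toTorus s +ᵥ q) 0 v) = v := by
      intro v
      rw [← torusDiff_comp (φ := fun s : Fin n → ℝ => toTorus s +ᵥ q) hk (hF 0), e,
        torusDiff_eq 𝓘(ℝ, Fin n → ℝ)
          (IsSmoothLiftAt.toTorus_comp (f := fun s => s + a) (hid.add contMDiffAt_const)),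
        vecDiff_add hid contMDiffAt_const, vecDiff_const, add_zero]
      exact DFunLike.congr_fun (mfderiv_id (I := 𝓘(ℝ, Fin n → ℝ)) (x := (0 : Fin n → ℝ))) v
    have h2 : ∀ v : TangentSpace 𝓘(ℝ, Fin n → ℝ) (0 : Fin n → ℝ),
        ζ (i q) (p (toTorus (0 : Fin n → ℝ) +ᵥ q))
          (mfderiv K J p (toTorus (0 : Fin n → ℝ) +ᵥ q)
            (mfderiv 𝓘(ℝ, Fin n → ℝ) K (fun s : Fin n → ℝ => toTorus s +ᵥ q) 0 v)) = 0 := by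
      intro v
      rw [form_mfderiv_comp (ζ (i q)) hp (φ := fun s : Fin n → ℝ => toTorus s +ᵥ q)
        (ψ := fun _ => p q) (hF 0) (fun s => hG.principal.proj_vadd _ _), mfderiv_const]
      exact map_zero _
    exact (hloc (i q) _ hα _).trans ((congrArg₂ (· + ·) (h1 v) (h2 v)).trans (add_zero v))
  · intro t q v
    have hF := hG.principal.contMDiff_vadd t
    have hα : p (t +ᵥ q) ∈ V (i q) := by
      rw [hG.principal.proj_vadd]; exact hi q
    obtain ⟨k, hk⟩ := (hG.coordinate (i q)).smooth _ hα
    obtain ⟨l, hl⟩ := (hG.coordinate (i q)).smooth _ (hi q)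
    obtain ⟨a, rfl⟩ := toTorus_surjective t
    -- Translation by a fixed element changes the coordinate by a constant and leaves the projection
    -- unchanged, hence preserves both summands of the form.
    have e : (fun z => θs (i q) (toTorus a +ᵥ z)) =ᶠ[𝓝 q] fun z => toTorus a + θs (i q) z := by
      filter_upwards [(hVo (i q)).mem_nhds (hi q)] with z hz
      exact (hG.coordinate (i q)).equivariant _ _ hz
    rw [hloc (i q) _ hα, coordForm_apply, coordForm_apply,
      form_mfderiv_comp (ζ (i q)) hp (φ := fun z => toTorus a +ᵥ z) (ψ := p) (hF q)
        (fun s => hG.principal.proj_vadd _ _),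
      ← torusDiff_comp (φ := fun z => toTorus a +ᵥ z) hk (hF q),
      torusDiff_congr ((isSmoothLiftAt_const a).add hl) e,
      torusDiff_add (isSmoothLiftAt_const a) hl, torusDiff_const, zero_add]

end Connection

/-! ### Isomorphism of bundles with the same cocycle -/

section Isomorphism

variable {EX : Type*} [NormedAddCommGroup EX] [NormedSpace ℝ EX]
  {HX : Type*} [TopologicalSpace HX] {J : ModelWithCorners ℝ EX HX}
  {X : Type*} [TopologicalSpace X] [ChartedSpace HX X]
  {EY : Type*} [NormedAddCommGroup EY] [NormedSpace ℝ EY]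
  {HY : Type*} [TopologicalSpace HY] {K : ModelWithCorners ℝ EY HY}
  {Y : Type*} [TopologicalSpace Y] [ChartedSpace HY Y]
  {EY' : Type*} [NormedAddCommGroup EY'] [NormedSpace ℝ EY']
  {HY' : Type*} [TopologicalSpace HY'] {K' : ModelWithCorners ℝ EY' HY'}
  {Y' : Type*} [TopologicalSpace Y'] [ChartedSpace HY' Y']
  {n : ℕ} [AddAction (Torus n) Y] [AddAction (Torus n) Y'] {ι : Type*}
  {V : ι → Set X} {c : ι → ι → X → Torus n} {p : Y → X} {θs : ι → Y → Torus n}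
  {p' : Y' → X} {θs' : ι → Y' → Torus n}

/-- A point of a principal bundle is determined by its projection and a fibre coordinate. -/
theorem IsFibreCoordinate.eq_of_eq {W : Set X} {θ : Y → Torus n}
    (hθ : IsFibreCoordinate K p W θ) (hp : IsPrincipalTorusBundle (n := n) J K p) {y z : Y}
    (hy : p y ∈ W) (h : p y = p z) (h' : θ y = θ z) : y = z := by
  obtain ⟨t, ht, -⟩ := hp.simply_transitive y z h
  have e := hθ.equivariant t y hy
  rw [show t +ᵥ y = z from ht, ← h'] at e
  rw [← ht, right_eq_add.1 e]
  exact (zero_vadd _ y).symm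

omit [AddAction (Torus n) Y'] in
/-- A map into a principal bundle is smooth if its projection and its fibre coordinate are. -/
theorem IsFibreCoordinate.contMDiffAt {W : Set X} {θ : Y → Torus n}
    (hθ : IsFibreCoordinate K p W θ) (hW : IsOpen W) (hp : IsPrincipalTorusBundle (n := n) J K p)
    {f : Y' → Y} {z : Y'} (hz : p (f z) ∈ W) (hf : ContMDiffAt K' J ∞ (fun w => p (f w)) z)
    {g : Y' → Fin n → ℝ} (hg : IsSmoothLiftAt K' (fun w => θ (f w)) g z) :
    ContMDiffAt K' K ∞ f z := by
  obtain ⟨S, σ, hS, hzS, hσ, hσp⟩ := hp.local_section (p (f z))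
  have hσf : ContMDiffAt K' K ∞ (fun w => σ (p (f w))) z :=
    (hσ.contMDiffAt (hS.mem_nhds hzS)).comp z hf
  obtain ⟨k, hk⟩ := hθ.smooth (σ (p (f z))) (by rwa [Set.mem_preimage, hσp _ hzS])
  have hl := hg.sub (hk.comp hσf)
  -- The section is translated by the difference between the coordinate of `f` and its own. The
  -- result has the projection and the coordinate of `f`, so it is `f` near `z`.
  have h1 : ContMDiffAt K' K ∞
      (fun w => toTorus (g w - k (σ (p (f w)))) +ᵥ σ (p (f w))) z :=
    hp.smooth_action.contMDiffAt.comp z (hl.1.prodMk hσf)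
  refine h1.congr_of_eventuallyEq ?_
  filter_upwards [hl.2, hf.continuousAt.eventually (hS.mem_nhds hzS),
    hf.continuousAt.eventually (hW.mem_nhds hz)] with w h2 h3 h4
  have h5 : p (σ (p (f w))) = p (f w) := hσp _ h3
  refine hθ.eq_of_eq hp h4 ?_ ?_
  · rw [hp.proj_vadd, h5]
  · rw [hθ.equivariant _ _ (by rw [h5]; exact h4), ← h2, sub_add_cancel]

namespace IsGluedTorusBundle

/-- Matching one fibre coordinate matches all of them, since both families are glued by the same
`c`. The point so prescribed is therefore independent of the index, and near each point a single
index can be used to prove smoothness. -/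
theorem exists_map (hG : IsGluedTorusBundle J K V c p θs)
    (hG' : IsGluedTorusBundle J K' V c p' θs') (hV : ∀ α, IsOpen (V α))
    (hcov : ∀ x, ∃ α, x ∈ V α) :
    ∃ φ : Y → Y', ContMDiff K K' ∞ φ ∧ (∀ y, p' (φ y) = p y) ∧
      ∀ α y, p y ∈ V α → θs' α (φ y) = θs α y := by
  have hpt : ∀ y, ∃ y', p' y' = p y ∧ ∀ α, p y ∈ V α → θs' α y' = θs α y := by
    intro y
    obtain ⟨α, hα⟩ := hcov (p y)
    -- The section serves only to provide a point in the fibre over `p y`, which is then translated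
    -- to have the required coordinate.
    obtain ⟨S, σ, -, hy, -, hσ⟩ := hG'.principal.local_section (p y)
    have h0 := hσ _ hy
    have h1 : p' ((θs α y - θs' α (σ (p y))) +ᵥ σ (p y)) = p y := by
      rw [hG'.principal.proj_vadd, h0]
    refine ⟨_, h1, fun β hβ => ?_⟩
    have h2 := hG'.gluing α β ((θs α y - θs' α (σ (p y))) +ᵥ σ (p y))
      (by rw [h1]; exact ⟨hα, hβ⟩)
    rw [(hG'.coordinate α).equivariant _ _ (h0.symm ▸ hα), sub_add_cancel, h1,
      ← hG.gluing α β y ⟨hα, hβ⟩] at h2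
    exact sub_right_injective h2
  choose φ hφ hφθ using hpt
  refine ⟨φ, fun y => ?_, hφ, fun α y hα => hφθ y α hα⟩
  obtain ⟨α, hα⟩ := hcov (p y)
  have hp : ContMDiffAt K J ∞ p y := hG.principal.smooth_proj y
  obtain ⟨g, hg⟩ := (hG.coordinate α).smooth y hα
  refine (hG'.coordinate α).contMDiffAt (hV α) hG'.principal (by rwa [hφ])
    (by simpa only [hφ] using hp) (hg.congr ?_)
  filter_upwards [hp.continuousAt.eventually ((hV α).mem_nhds hα)] with z hz
  exact hφθ z α hz

/-- Torus bundles glued by the same cocycle are isomorphic. -/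
theorem exists_diffeomorph (hG : IsGluedTorusBundle J K V c p θs)
    (hG' : IsGluedTorusBundle J K' V c p' θs') (hV : ∀ α, IsOpen (V α))
    (hcov : ∀ x, ∃ α, x ∈ V α) :
    ∃ φ : Diffeomorph K K' Y Y' ∞, (∀ (t : Torus n) y, φ (t +ᵥ y) = t +ᵥ φ y) ∧
      (∀ y, p' (φ y) = p y) ∧ ∀ α y, p y ∈ V α → θs' α (φ y) = θs α y := by
  obtain ⟨φ, hφ, h1, h2⟩ := hG.exists_map hG' hV hcov
  obtain ⟨ψ, hψ, h3, h4⟩ := hG'.exists_map hG hV hcov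
  refine ⟨⟨⟨φ, ψ, fun y => ?_, fun y => ?_⟩, hφ, hψ⟩, fun t y => ?_, h1, h2⟩
  · obtain ⟨α, hα⟩ := hcov (p y)
    have e : p (ψ (φ y)) = p y := by rw [h3, h1]
    refine (hG.coordinate α).eq_of_eq hG.principal (by rwa [e]) e ?_
    rw [h4 α _ (by rwa [h1]), h2 α _ hα]
  · obtain ⟨α, hα⟩ := hcov (p' y)
    have e : p' (φ (ψ y)) = p' y := by rw [h1, h3]
    refine (hG'.coordinate α).eq_of_eq hG'.principal (by rwa [e]) e ?_
    rw [h2 α _ (by rwa [h3]), h4 α _ hα]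
  · obtain ⟨α, hα⟩ := hcov (p y)
    have e : p (t +ᵥ y) = p y := hG.principal.proj_vadd t y
    change φ (t +ᵥ y) = t +ᵥ φ y
    refine (hG'.coordinate α).eq_of_eq hG'.principal (by rwa [h1, e]) ?_ ?_
    · rw [hG'.principal.proj_vadd, h1, h1, e]
    · rw [h2 α _ (by rwa [e]), (hG'.coordinate α).equivariant _ _ (by rwa [h1]),
        (hG.coordinate α).equivariant _ _ hα, h2 α _ hα]

end IsGluedTorusBundle

end Isomorphism

/-! ### The local forms on `X` and their differences -/

section Gerbe

variable {E : Type*} [NormedAddCommGroup E] [NormedSpace ℝ E]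
  {H : Type*} [TopologicalSpace H] {I : ModelWithCorners ℝ E H}
  {EX : Type*} [NormedAddCommGroup EX] [NormedSpace ℝ EX]
  {HX : Type*} [TopologicalSpace HX] {J : ModelWithCorners ℝ EX HX}
  {M : Type*} [TopologicalSpace M] [ChartedSpace H M] [IsManifold I ∞ M]
  {X : Type u} [TopologicalSpace X] [ChartedSpace HX X] [IsManifold J ∞ X]
  {n : ℕ} [AddAction (Torus n) X] {ι : Type*}
  {U : ι → Set M} {lam : ι → ι → M → Fin n → ℝ}
  {A : ι → ∀ x : M, TangentSpace I x →L[ℝ] (Fin n → ℝ)}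
  {π : X → M} {θ : ι → X → Torus n}
  {Θ : ∀ x : X, TangentSpace J x →L[ℝ] (Fin n → ℝ)}
  {m : ι → ι → M → Matrix (Fin n) (Fin n) ℤ} {h : ι → ι → M → Fin n → ℝ}
  {B₀ : ι → M → Matrix (Fin n) (Fin n) ℝ}
  {B₁ : ι → ∀ x : M, TangentSpace I x →L[ℝ] (Fin n → ℝ)}

/-- The form `π^* b₁ - b₀ Θ` on `X`. -/
def gerbeForm (J : ModelWithCorners ℝ EX HX) (π : X → M)
    (Θ : ∀ x : X, TangentSpace J x →L[ℝ] (Fin n → ℝ)) (b₀ : M → Matrix (Fin n) (Fin n) ℝ)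
    (b₁ : ∀ x : M, TangentSpace I x →L[ℝ] (Fin n → ℝ)) (x : X) :
    TangentSpace J x →L[ℝ] (Fin n → ℝ) :=
  (b₁ (π x)).comp (mfderiv J I π x) - (b₀ (π x)).mulVecLin.toContinuousLinearMap.comp (Θ x)

omit [IsManifold I ∞ M] [IsManifold J ∞ X] [AddAction (Torus n) X] in
theorem gerbeForm_apply (b₀ : M → Matrix (Fin n) (Fin n) ℝ)
    (b₁ : ∀ x : M, TangentSpace I x →L[ℝ] (Fin n → ℝ)) (x : X) (v : TangentSpace J x) :
    gerbeForm J π Θ b₀ b₁ x v = b₁ (π x) (mfderiv J I π x v) - b₀ (π x) *ᵥ Θ x v := rfl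

theorem smoothFormOn_gerbeForm (hX : IsLocalTorusBundle I J U lam A π θ Θ)
    (hB : IsInvariantGerbe I U lam A m h B₀ B₁) (α : ι) :
    SmoothFormOn J (π ⁻¹' U α) (gerbeForm J π Θ (B₀ α) (B₁ α)) := by
  have hπ := hX.glued.principal.smooth_proj
  refine ((hB.B₁_smooth α).pullback hπ).sub (SmoothFormOn.mulVec (b := fun x => B₀ α (π x)) ?_
    (hX.connection.smooth.mono (Set.subset_univ _)))
  exact fun i j => (hB.B₀_smooth α i j).comp hπ.contMDiffOn fun x hx => hx

/-- The difference of the `B₁` terms is `dh + m (A β - ½ d lam β α)`, and that of the `B₀` terms is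
`m Θ = m (dθ β + A β)`. Subtracting cancels `A β` and leaves `dh - m (dθ β + ½ d lam β α)`, the
differential of `lamSharp` with `m` locally constant. -/
theorem gerbeForm_sub_gerbeForm (hX : IsLocalTorusBundle I J U lam A π θ Θ)
    (hB : IsInvariantGerbe I U lam A m h B₀ B₁) {α β : ι} {x : X} (hα : π x ∈ U α)
    (hβ : π x ∈ U β) (w : TangentSpace J x) :
    gerbeForm J π Θ (B₀ α) (B₁ α) x w - gerbeForm J π Θ (B₀ β) (B₁ β) x w =
      torusDiff J (lamSharp lam m h π θ α β) x w := by
  have hπ : ContMDiffAt J I ∞ π x := hX.glued.principal.smooth_proj x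
  obtain ⟨g, hg⟩ := (hX.glued.coordinate β).smooth x hβ
  have hh := hB.contMDiffAt_h_comp hX hα hβ
  have hl := hX.contMDiffAt_lam_comp hβ hα
  have hU := ((hX.isOpen α).inter (hX.isOpen β)).mem_nhds ⟨hα, hβ⟩
  have hU' := ((hX.isOpen β).inter (hX.isOpen α)).mem_nhds ⟨hβ, hα⟩
  have s1 := hg.1.mulVec (realMatrix (m α β (π x)))
  have s2 := hl.mulVec ((1 / 2 : ℝ) • realMatrix (m α β (π x)))
  have s3 : ContMDiffAt J 𝓘(ℝ, Fin n → ℝ) ∞ (fun y => realMatrix (m α β (π x)) *ᵥ g y +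
      ((1 / 2 : ℝ) • realMatrix (m α β (π x))) *ᵥ lam β α (π y)) x := s1.add s2
  rw [torusDiff_eq J (isSmoothLiftAt_lamSharp hX hB hα hβ hg), vecDiff_sub hh s3,
    vecDiff_add s1 s2,
    vecDiff_mulVec _ hg.1, vecDiff_mulVec _ hl,
    vecDiff_comp (f := h α β) ((hB.h_smooth α β).contMDiffAt hU) hπ,
    vecDiff_comp (f := lam β α) ((hX.lam_smooth β α).contMDiffAt hU') hπ,
    gerbeForm_apply, gerbeForm_apply]
  have e1 := hB.B₁_gluing α β (π x) ⟨hα, hβ⟩ (mfderiv J I π x w)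
  have e2 := hB.B₀_gluing α β (π x) ⟨hα, hβ⟩
  -- `Θ` is expanded in the coordinate of index `β` because `B₁_gluing` and `lamSharp` are both
  -- written in terms of `β`.
  have e3 := hX.connection_local β x hβ w
  rw [torusDiff_eq J hg] at e3
  rw [e3, sub_sub_sub_comm, e1, ← Matrix.sub_mulVec, e2, Matrix.mulVec_sub, Matrix.mulVec_add,
    Matrix.mulVec_smul, Matrix.smul_mulVec]
  abel

end Gerbe

/-! ### Compatibility of isomorphisms with connections -/

section SharpBundle

variable {E : Type*} [NormedAddCommGroup E] [NormedSpace ℝ E]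
  {H : Type*} [TopologicalSpace H] {I : ModelWithCorners ℝ E H}
  {EX : Type*} [NormedAddCommGroup EX] [NormedSpace ℝ EX]
  {HX : Type*} [TopologicalSpace HX] {J : ModelWithCorners ℝ EX HX}
  {M : Type*} [TopologicalSpace M] [ChartedSpace H M] [IsManifold I ∞ M]
  {X : Type*} [TopologicalSpace X] [ChartedSpace HX X] [IsManifold J ∞ X]
  {EY : Type*} [NormedAddCommGroup EY] [NormedSpace ℝ EY]
  {HY : Type*} [TopologicalSpace HY] {K : ModelWithCorners ℝ EY HY}
  {Y : Type*} [TopologicalSpace Y] [ChartedSpace HY Y] [IsManifold K ∞ Y]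
  {EY' : Type*} [NormedAddCommGroup EY'] [NormedSpace ℝ EY']
  {HY' : Type*} [TopologicalSpace HY'] {K' : ModelWithCorners ℝ EY' HY'}
  {Y' : Type*} [TopologicalSpace Y'] [ChartedSpace HY' Y'] [IsManifold K' ∞ Y']
  {n : ℕ} [AddAction (Torus n) Y] [AddAction (Torus n) Y'] {ι : Type*}
  {U : ι → Set M} {c : ι → ι → X → Torus n}
  {B₀ : ι → M → Matrix (Fin n) (Fin n) ℝ}
  {B₁ : ι → ∀ x : M, TangentSpace I x →L[ℝ] (Fin n → ℝ)}
  {π : X → M} {Θ : ∀ x : X, TangentSpace J x →L[ℝ] (Fin n → ℝ)}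
  {p : Y → X} {θs : ι → Y → Torus n} {Θs : ∀ y : Y, TangentSpace K y →L[ℝ] (Fin n → ℝ)}
  {p' : Y' → X} {θs' : ι → Y' → Torus n} {Θs' : ∀ y : Y', TangentSpace K' y →L[ℝ] (Fin n → ℝ)}

omit [IsManifold I ∞ M] [IsManifold J ∞ X] in
/-- An isomorphism of sharp bundles that respects the fibre coordinates respects the
connections. -/
theorem IsSharpBundle.connection_comp_map
    (hS : IsSharpBundle I J K U c B₀ B₁ π Θ p θs Θs)
    (hS' : IsSharpBundle I J K' U c B₀ B₁ π Θ p' θs' Θs') (hU : ∀ α, IsOpen (π ⁻¹' U α))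
    (hcov : ∀ x, ∃ α, x ∈ π ⁻¹' U α) {φ : Y → Y'} (hφ : ContMDiff K K' ∞ φ)
    (hp : ∀ y, p' (φ y) = p y) (hθ : ∀ α y, π (p y) ∈ U α → θs' α (φ y) = θs α y)
    (y : Y) (v : TangentSpace K y) : Θs' (φ y) (mfderiv K K' φ y v) = Θs y v := by
  obtain ⟨α, hα⟩ := hcov (p y)
  have hα' : π (p' (φ y)) ∈ U α := by rw [hp]; exact hα
  obtain ⟨k, hk⟩ := (hS'.glued.coordinate α).smooth _ hα'
  obtain ⟨l, hl⟩ := (hS.glued.coordinate α).smooth _ hα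
  have e : (fun z => θs' α (φ z)) =ᶠ[𝓝 y] θs α := by
    filter_upwards [((hU α).preimage hS.glued.principal.smooth_proj.continuous).mem_nhds hα]
      with z hz using hθ α z hz
  have h1 := hS.connection_local α y hα v
  have h2 := hS'.connection_local α (φ y) hα' (mfderiv K K' φ y v)
  -- Both connections become a coordinate differential plus the pullback of the same form on `X`,
  -- which `φ` preserves because it covers the identity.
  rw [add_sub_assoc, ← gerbeForm_apply (J := J) (B₀ α) (B₁ α)] at h1 h2
  rw [h1, h2, form_mfderiv_comp (gerbeForm J π Θ (B₀ α) (B₁ α)) hS'.glued.principal.smooth_proj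
    (hφ y) hp, ← torusDiff_comp hk (hφ y), torusDiff_congr hl e]

end SharpBundle

end

theorem mainTheorem3 {n : ℕ} {ι : Type*}
    {E : Type*} [NormedAddCommGroup E] [NormedSpace ℝ E] [FiniteDimensional ℝ E]
    {H : Type*} [TopologicalSpace H] (I : ModelWithCorners ℝ E H) [I.Boundaryless]
    {EX : Type*} [NormedAddCommGroup EX] [NormedSpace ℝ EX] [FiniteDimensional ℝ EX]
    {HX : Type*} [TopologicalSpace HX] (J : ModelWithCorners ℝ EX HX) [J.Boundaryless]
    {M : Type*} [TopologicalSpace M] [ChartedSpace H M] [IsManifold I ∞ M]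
    [T2Space M] [SecondCountableTopology M]
    {X : Type u} [TopologicalSpace X] [ChartedSpace HX X] [IsManifold J ∞ X]
    [T2Space X] [SecondCountableTopology X] [AddAction (Torus n) X]
    (U : ι → Set M) (lam : ι → ι → M → Fin n → ℝ)
    (A : ι → ∀ x : M, TangentSpace I x →L[ℝ] (Fin n → ℝ))
    (π : X → M) (θ : ι → X → Torus n)
    (Θ : ∀ x : X, TangentSpace J x →L[ℝ] (Fin n → ℝ))
    (hX : IsLocalTorusBundle I J U lam A π θ Θ)
    (m : ι → ι → M → Matrix (Fin n) (Fin n) ℤ) (h : ι → ι → M → Fin n → ℝ)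
    (B₀ : ι → M → Matrix (Fin n) (Fin n) ℝ)
    (B₁ : ι → ∀ x : M, TangentSpace I x →L[ℝ] (Fin n → ℝ))
    (hB : IsInvariantGerbe I U lam A m h B₀ B₁) :
    (∀ α β, TorusSmoothOn J (lamSharp lam m h π θ α β) (π ⁻¹' (U α ∩ U β))) ∧
    (∀ α β γ x, π x ∈ U α ∩ U β ∩ U γ →
      lamSharp lam m h π θ α β x + lamSharp lam m h π θ β γ x
        + lamSharp lam m h π θ γ α x = 0) ∧
    ∃ (Y : Type u) (_ : TopologicalSpace Y) (_ : ChartedSpace (ModelProd HX (Fin n → ℝ)) Y)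
      (_ : IsManifold (J.prod 𝓘(ℝ, Fin n → ℝ)) ∞ Y) (_ : AddAction (Torus n) Y)
      (p : Y → X) (θs : ι → Y → Torus n)
      (Θs : ∀ y : Y, TangentSpace (J.prod 𝓘(ℝ, Fin n → ℝ)) y →L[ℝ] (Fin n → ℝ)),
      T2Space Y ∧ SecondCountableTopology Y ∧
      IsSharpBundle I J (J.prod 𝓘(ℝ, Fin n → ℝ)) U (lamSharp lam m h π θ) B₀ B₁ π Θ p θs Θs ∧
      -- the bundle with its fibre coordinates and connection is unique up to isomorphism
      ∀ (Y' : Type u) (_ : TopologicalSpace Y') (_ : ChartedSpace (ModelProd HX (Fin n → ℝ)) Y')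
        (_ : IsManifold (J.prod 𝓘(ℝ, Fin n → ℝ)) ∞ Y') (_ : AddAction (Torus n) Y')
        (p' : Y' → X) (θs' : ι → Y' → Torus n)
        (Θs' : ∀ y : Y', TangentSpace (J.prod 𝓘(ℝ, Fin n → ℝ)) y →L[ℝ] (Fin n → ℝ)),
        IsSharpBundle I J (J.prod 𝓘(ℝ, Fin n → ℝ)) U (lamSharp lam m h π θ) B₀ B₁ π Θ
          p' θs' Θs' →
        ∃ φ : Diffeomorph (J.prod 𝓘(ℝ, Fin n → ℝ)) (J.prod 𝓘(ℝ, Fin n → ℝ)) Y Y' ∞,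
          (∀ (t : Torus n) y, φ (t +ᵥ y) = t +ᵥ φ y) ∧
          (∀ y, p' (φ y) = p y) ∧
          (∀ α y, π (p y) ∈ U α → θs' α (φ y) = θs α y) ∧
          (∀ y (v : TangentSpace (J.prod 𝓘(ℝ, Fin n → ℝ)) y),
            Θs' (φ y) (mfderiv (J.prod 𝓘(ℝ, Fin n → ℝ)) (J.prod 𝓘(ℝ, Fin n → ℝ)) φ y v)
              = Θs y v) := by
  have hc := isTorusCocycle_lamSharp hX hB
  refine ⟨torusSmoothOn_lamSharp hX hB, lamSharp_cocycle hX hB, ?_⟩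
  obtain ⟨Y, tY, cY, mY, aY, p, θs, hT2, hSC, hG⟩ := exists_isGluedTorusBundle hc
  obtain ⟨Θs, hΘ, hloc⟩ := hG.exists_connection hc (smoothFormOn_gerbeForm hX hB)
    fun α β x hx w => gerbeForm_sub_gerbeForm hX hB hx.1 hx.2 w
  have hS : IsSharpBundle I J (J.prod 𝓘(ℝ, Fin n → ℝ)) U (lamSharp lam m h π θ) B₀ B₁ π Θ
      p θs Θs := by
    refine ⟨hG, hΘ, fun α y hy v => ?_⟩
    rw [hloc α y hy, coordForm_apply, gerbeForm_apply, add_sub_assoc]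
  refine ⟨Y, tY, cY, mY, aY, p, θs, Θs, hT2, hSC, hS, ?_⟩
  intro Y' tY' cY' mY' aY' p' θs' Θs' hS'
  -- The isomorphism is built from the fibre coordinates alone; its compatibility with the
  -- connections is then automatic.
  obtain ⟨φ, h1, h2, h3⟩ := hG.exists_diffeomorph hS'.glued hc.isOpen hc.exists_mem
  exact ⟨φ, h1, h2, h3,
    hS.connection_comp_map hS' hc.isOpen hc.exists_mem φ.contMDiff h2 h3⟩
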